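/- Let $n\ge 1$, $d\ge 1$ be integers, $V=\mathbb C^n$ with coordinates $w_1,\dots,w_n$, $A_V=\mathbb C[w_1,\dots,w_n]$, and let $D_V=A_V\langle\partial_{w_1},\dots,\partial_{w_n}\rangle$ be the ring of algebraic differential operators, filtered by order, with $\operatorname{Gr}D_V=A_V[\xi_1,\dots,\xi_n]$, $\xi_i=\sigma(\partial_{w_i})$. Let $h\in A_V$ be a reduced polynomial which is quasi-homogeneous of degree $d$ with respect to weights $p_1,\dots,p_n\in\mathbb Q$, and put $\chi=\sum_{i=1}^n p_iw_i\partial_{w_i}$. Suppose that $D=\{h=0\}$ is a free divisor: the $A_V$-module $\operatorname{Der}(-\log D)=\{\theta\in\operatorname{Der}_{\mathbb C}(A_V):\theta(h)\in (h)\}$ has a basis $\delta_1,\dots,\delta_{n-1},\chi$ with $\delta_i(h)=0$ for $i=1,\dots,n-1$. Suppose moreover that $D$ is strongly Koszul: the symbols $h,\sigma(\delta_1),\dots,\sigma(\delta_{n-1})$ form a regular sequence in $\operatorname{Gr}D_V$. Let $\widetilde V=\mathbb C\times V$ with coordinates $w_0,w_1,\dots,w_n$, and let $D_{\widetilde V}$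 be its ring of algebraic differential operators, filtered by order, with $\operatorname{Gr}D_{\widetilde V}=\mathbb C[w_0,\dots,w_n][\xi_0,\dots,\xi_n]$. Let $c\in\mathbb C\setminus\{0\}$, $\widetilde\chi=\chi+w_0\partial_{w_0}$, and for $\beta\in\mathbb C$ let $$I(\beta)=D_{\widetilde V}\langle h-cw_0^d,\ \delta_1,\dots,\delta_{n-1},\ \widetilde\chi-d\beta\rangle,\qquad N(\beta)=D_{\widetilde V}/I(\beta)$$ (left ideal and left module). Then, for every $\beta\in\mathbb C$: 1. $N(\beta)$ is a holonomic $D_{\widetilde V}$-module (finitely generated, and zero or with characteristic variety of dimension $n+1$); 2. $h-cw_0^d,\delta_1,\dots,\delta_{n-1},\widetilde\chi-d\beta$ is an involutive basis of $I(\beta)$, i.e. their symbols generate the ideal $\sigma(I(\beta))\subset\operatorname{Gr}D_{\widetilde V}$ generated by the symbols of all elements of $I(\beta)$; 3. the symbols $h-cw_0^d,\sigma(\delta_1),\dots,\sigma(\delta_{n-1}),\sigma(\chi)+w_0\xi_0$ of these generators form a regular sequence in $\operatorname{Gr}D_{\widetilde V}$. -/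

import Mathlib

namespace AlgDMod

open MvPolynomial

/-- The polynomial ring `ℂ[x_0, …, x_{N-1}]`. -/
abbrev PolyRing (N : ℕ) : Type := MvPolynomial (Fin N) ℂ

/-- The polynomial ring `ℂ[x][ξ_0, …, ξ_{N-1}]`, i.e. the graded ring of the order filtration of the
ring of differential operators, `ξ_i` being the symbol of `∂_i`. The inner variables are the `x_i`,
the outer ones the `ξ_i`; degrees are degrees in the `ξ_i`. -/
abbrev Gr (N : ℕ) : Type := MvPolynomial (Fin N) (PolyRing N)

/-- The operator of multiplication by the polynomial `f`. -/
noncomputable def mulOp {N : ℕ} (f : PolyRing N) : Module.End ℂ (PolyRing N) := LinearMap.mulLeft ℂ f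

/-- The operator `∂_i = ∂ / ∂ x_i`. -/
noncomputable def partialOp {N : ℕ} (i : Fin N) : Module.End ℂ (PolyRing N) := (pderiv i).toLinearMap

/-- The ring `ℂ[x]⟨∂⟩` of algebraic differential operators on affine `N`-space, as an algebra of
operators on `ℂ[x]`. -/
noncomputable def weylAlgebra (N : ℕ) : Subalgebra ℂ (Module.End ℂ (PolyRing N)) :=
  Algebra.adjoin ℂ (Set.range mulOp ∪ Set.range partialOp)

/-- The ring of differential operators as a type. -/
def D (N : ℕ) : Type := weylAlgebra N

noncomputable instance instRingD (N : ℕ) : Ring (D N) :=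
  inferInstanceAs (Ring (weylAlgebra N))

noncomputable instance instAlgebraD (N : ℕ) : Algebra ℂ (D N) :=
  inferInstanceAs (Algebra ℂ (weylAlgebra N))

/-- The inclusion of the ring of differential operators into the ring of all linear operators. -/
noncomputable def toOp (N : ℕ) : D N →ₐ[ℂ] Module.End ℂ (PolyRing N) := (weylAlgebra N).val

theorem mulOp_mem {N : ℕ} (f : PolyRing N) : mulOp f ∈ weylAlgebra N :=
  Algebra.subset_adjoin (Or.inl ⟨f, rfl⟩)

theorem partialOp_mem {N : ℕ} (i : Fin N) : partialOp i ∈ weylAlgebra N :=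
  Algebra.subset_adjoin (Or.inr ⟨i, rfl⟩)

theorem derivation_mem {N : ℕ} (θ : Derivation ℂ (PolyRing N) (PolyRing N)) :
    (θ.toLinearMap : Module.End ℂ (PolyRing N)) ∈ weylAlgebra N := by
  have hs : ∀ (s : Finset (Fin N)) (F : Fin N → Derivation ℂ (PolyRing N) (PolyRing N)) (f : PolyRing N),
      (∑ i ∈ s, F i) f = ∑ i ∈ s, F i f := fun s F f => by
    induction s using Finset.induction_on with
    | empty => simp
    | insert a s ha ih => rw [Finset.sum_insert ha, Finset.sum_insert ha, Derivation.add_apply, ih]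
  have h1 : θ = ∑ i, θ (X i) • pderiv (R := ℂ) i := by
    apply MvPolynomial.derivation_ext
    intro j
    rw [hs, Finset.sum_eq_single j]
    · simp
    · intro b _ hb
      simp [pderiv_X, hb.symm]
    · simp
  have key : (θ.toLinearMap : Module.End ℂ (PolyRing N)) =
      ∑ i, mulOp (θ (X i)) * partialOp i := by
    apply LinearMap.ext
    intro f
    have h2 : θ f = (∑ i, θ (X i) • pderiv (R := ℂ) i) f := congrArg (fun t => t f) h1
    rw [hs] at h2
    simpa [mulOp, partialOp, LinearMap.sum_apply] using h2
  rw [key]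
  exact Subalgebra.sum_mem _ fun i _ => Subalgebra.mul_mem _ (mulOp_mem _) (partialOp_mem i)

/-- A polynomial as a differential operator of order zero. -/
noncomputable def ofPoly {N : ℕ} (f : PolyRing N) : D N := ⟨mulOp f, mulOp_mem f⟩

/-- A polynomial vector field as a differential operator. -/
noncomputable def ofDer {N : ℕ} (θ : Derivation ℂ (PolyRing N) (PolyRing N)) : D N := ⟨θ.toLinearMap, derivation_mem θ⟩

/-! ### Normal forms `∑ f_α ∂^α`, order filtration, symbols -/

theorem partialOp_commute {N : ℕ} (i j : Fin N) :
    Commute (partialOp i : Module.End ℂ (PolyRing N)) (partialOp j) := by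
  have h0 : ⁅pderiv (R := ℂ) i, pderiv (R := ℂ) j⁆ = 0 := by
    apply MvPolynomial.derivation_ext
    intro k
    rw [Derivation.commutator_apply]
    simp only [pderiv_X, Pi.single_apply]
    split_ifs <;> simp
  apply LinearMap.ext
  intro f
  have h1 := congrArg (fun t => t f) h0
  simp only [Derivation.commutator_apply, Derivation.zero_apply] at h1
  exact sub_eq_zero.mp h1

theorem partialOp_pow_pairwise {N : ℕ} (α : Fin N →₀ ℕ) :
    ((Finset.univ : Finset (Fin N)) : Set (Fin N)).Pairwise
      (Function.onFun Commute fun i => (partialOp i : Module.End ℂ (PolyRing N)) ^ α i) :=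
  fun i _ j _ _ => (partialOp_commute i j).pow_pow _ _

/-- The operator `∂^α = ∏ i, ∂_i ^ α_i`. -/
noncomputable def partialPow {N : ℕ} (α : Fin N →₀ ℕ) : Module.End ℂ (PolyRing N) :=
  Finset.univ.noncommProd (fun i => partialOp i ^ α i) (partialOp_pow_pairwise α)

/-- The operator `∑ f_α ∂^α` attached to the polynomial `∑ f_α ξ^α`: the `ℂ[x]`-linear map that
sends `ξ^α` to `∂^α`. -/
noncomputable def normalOrder (N : ℕ) : Gr N →ₗ[ℂ] Module.End ℂ (PolyRing N) :=
  ((MvPolynomial.basisMonomials (Fin N) (PolyRing N)).constr (PolyRing N) partialPow).restrictScalars ℂ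

theorem normalOrder_monomial {N : ℕ} (α : Fin N →₀ ℕ) (f : PolyRing N) :
    normalOrder N (monomial α f) = mulOp f * partialPow α := by
  have h1 : (monomial α f : Gr N) = f • MvPolynomial.basisMonomials (Fin N) (PolyRing N) α := by
    simp [smul_monomial]
  rw [h1, normalOrder, LinearMap.restrictScalars_apply, LinearMap.map_smul,
    Module.Basis.constr_basis]
  rfl

theorem partialPow_zero {N : ℕ} : partialPow (0 : Fin N →₀ ℕ) = 1 := by
  rw [partialPow, Finset.noncommProd_eq_pow_card _ _ _ 1 (by simp), one_pow]

theorem partialPow_succ {N : ℕ} (α : Fin N →₀ ℕ) (j : Fin N) :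
    partialPow (α + Finsupp.single j 1) = partialPow α * partialOp j := by
  have h1 : ∀ s : Finset (Fin N), ∀ (h : (s : Set (Fin N)).Pairwise (Function.onFun Commute
        fun i => (partialOp i : Module.End ℂ (PolyRing N)) ^ α i))
      (h' : (s : Set (Fin N)).Pairwise (Function.onFun Commute
        fun i => (partialOp i : Module.End ℂ (PolyRing N)) ^ (α + Finsupp.single j 1 : Fin N →₀ ℕ) i)),
      s.noncommProd _ h' = s.noncommProd _ h * (if j ∈ s then partialOp j else 1) := by
    intro s
    induction s using Finset.induction_on with
    | empty => intro h h'; simp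
    | insert a s ha ih =>
      intro h h'
      rw [Finset.noncommProd_insert_of_notMem _ _ _ _ ha,
        Finset.noncommProd_insert_of_notMem _ _ _ _ ha,
        ih (h.mono (by simp)) (h'.mono (by simp))]
      by_cases hj : j = a
      · subst hj
        have hc : Commute (partialOp j) (s.noncommProd
            (fun i => (partialOp i : Module.End ℂ (PolyRing N)) ^ α i) (h.mono (by simp))) :=
          Finset.noncommProd_commute _ _ _ _ fun i _ => (partialOp_commute j i).pow_right _
        simp only [ha, Finsupp.add_apply, Finsupp.single_eq_same, pow_succ, if_false, mul_one,
          Finset.mem_insert, true_or, if_true, mul_assoc, hc.eq]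
      · have hj' : a ≠ j := fun h => hj h.symm
        simp [hj, hj', mul_assoc]
  have := h1 Finset.univ (partialOp_pow_pairwise α) (partialOp_pow_pairwise _)
  simpa [partialPow] using this

theorem normalOrder_C {N : ℕ} (f : PolyRing N) : normalOrder N (C f) = mulOp f := by
  rw [← monomial_zero', normalOrder_monomial, partialPow_zero, mul_one]

theorem normalOrder_C_mul {N : ℕ} (f : PolyRing N) (p : Gr N) :
    normalOrder N (C f * p) = mulOp f * normalOrder N p := by
  induction p using MvPolynomial.induction_on' with
  | monomial α g =>
    rw [C_mul_monomial, normalOrder_monomial, normalOrder_monomial, ← mul_assoc]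
    congr 1
    exact LinearMap.ext fun u => mul_assoc f g u
  | add p q hp hq => rw [mul_add, map_add, hp, hq, map_add, mul_add]

theorem normalOrder_mul_X {N : ℕ} (p : Gr N) (j : Fin N) :
    normalOrder N (p * X j) = normalOrder N p * partialOp j := by
  induction p using MvPolynomial.induction_on' with
  | monomial α g =>
    rw [X, monomial_mul, normalOrder_monomial, normalOrder_monomial, mul_one, partialPow_succ,
      mul_assoc]
  | add p q hp hq => rw [add_mul, map_add, hp, hq, map_add, add_mul]

theorem normalOrder_mul_var {N : ℕ} (p : Gr N) (i : Fin N) :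
    normalOrder N p * mulOp (X i) = mulOp (X i) * normalOrder N p + normalOrder N (pderiv i p) := by
  induction p using MvPolynomial.induction_on with
  | C f =>
    rw [normalOrder_C, pderiv_C, map_zero, add_zero]
    exact LinearMap.ext fun u => mul_left_comm f (X i) u
  | add p q hp hq => simp only [map_add, add_mul, mul_add, hp, hq]; abel
  | mul_X p j hp =>
    have h1 : (partialOp j : Module.End ℂ (PolyRing N)) * mulOp (X i) =
        mulOp (X i) * partialOp j + if j = i then 1 else 0 := by
      apply LinearMap.ext
      intro u
      by_cases h : j = i
      · subst h
        simp [partialOp, mulOp, add_comm]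
      · have h' : i ≠ j := fun e => h e.symm
        simp [partialOp, mulOp, h, h', pderiv_X]
    have h2 : pderiv i (p * X j) = pderiv i p * X j + if j = i then p else 0 := by
      rw [pderiv_mul, pderiv_X, Pi.single_apply]
      split_ifs <;> simp
    rw [normalOrder_mul_X, mul_assoc, h1, mul_add, ← mul_assoc, hp, h2, map_add, normalOrder_mul_X,
      add_mul, mul_assoc, add_assoc]
    congr 2
    split_ifs <;> simp

theorem normalOrder_injective (N : ℕ) : Function.Injective (normalOrder N) := by
  rw [injective_iff_map_eq_zero]
  have h1 : ∀ p : Gr N, normalOrder N p 1 = constantCoeff p := by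
    intro p
    induction p using MvPolynomial.induction_on with
    | C f => simp [normalOrder_C, mulOp]
    | add p q hp hq => simp [hp, hq]
    | mul_X p j hp => simp [normalOrder_mul_X, partialOp]
  have h2 : ∀ (k : ℕ) (α : Fin N →₀ ℕ) (p : Gr N), α.degree = k → normalOrder N p = 0 →
      coeff α p = 0 := by
    intro k
    induction k with
    | zero =>
      intro α p hα hp
      have := h1 p
      rw [hp, LinearMap.zero_apply, constantCoeff_eq] at this
      rw [(Finsupp.degree_eq_zero_iff α).mp hα]
      exact this.symm
    | succ k ih =>
      intro α p hα hp
      have hne : α ≠ 0 := by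
        rintro rfl
        simp at hα
      obtain ⟨i, hi⟩ := Finsupp.ne_iff.mp hne
      have hle : Finsupp.single i 1 ≤ α := by
        rw [Finsupp.single_le_iff]
        exact Nat.one_le_iff_ne_zero.mpr hi
      have hdec : α - Finsupp.single i 1 + Finsupp.single i 1 = α := tsub_add_cancel_of_le hle
      have hq : normalOrder N (pderiv i p) = 0 := by
        have := normalOrder_mul_var p i
        rw [hp, zero_mul, mul_zero, zero_add] at this
        exact this.symm
      have hd : (α - Finsupp.single i 1).degree = k := by
        have := congrArg Finsupp.degree hdec
        rw [map_add, Finsupp.degree_single, hα] at this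
        exact Nat.succ_injective this
      have h3 := ih _ _ hd hq
      rw [coeff_pderiv, hdec] at h3
      refine (mul_eq_zero.mp h3).resolve_right ?_
      exact Nat.cast_add_one_ne_zero _
  exact fun p hp => MvPolynomial.ext _ _ fun α => by rw [h2 _ α p rfl hp, coeff_zero]

theorem range_normalOrder (N : ℕ) :
    LinearMap.range (normalOrder N) = Subalgebra.toSubmodule (weylAlgebra N) := by
  apply le_antisymm
  · rintro _ ⟨p, rfl⟩
    rw [Subalgebra.mem_toSubmodule]
    induction p using MvPolynomial.induction_on with
    | C f => rw [normalOrder_C]; exact mulOp_mem f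
    | add p q hp hq => rw [map_add]; exact add_mem hp hq
    | mul_X p j hp => rw [normalOrder_mul_X]; exact mul_mem hp (partialOp_mem j)
  · have h1 : ∀ (i : Fin N) (p : Gr N), ∃ q, normalOrder N q = partialOp i * normalOrder N p := by
      intro i p
      induction p using MvPolynomial.induction_on with
      | C f =>
        refine ⟨C f * X i + C (pderiv i f), ?_⟩
        rw [map_add, normalOrder_mul_X, normalOrder_C, normalOrder_C]
        exact LinearMap.ext fun u => by simp [mulOp, partialOp]; ring
      | add p q hp hq =>
        obtain ⟨p', hp'⟩ := hp
        obtain ⟨q', hq'⟩ := hq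
        exact ⟨p' + q', by rw [map_add, map_add, hp', hq', mul_add]⟩
      | mul_X p j hp =>
        obtain ⟨q, hq⟩ := hp
        exact ⟨q * X j, by rw [normalOrder_mul_X, normalOrder_mul_X, hq, mul_assoc]⟩
    have h2 : ∀ P ∈ weylAlgebra N, ∀ p : Gr N, ∃ q, normalOrder N q = P * normalOrder N p := by
      intro P hP
      induction hP using Algebra.adjoin_induction with
      | mem P hP =>
        rcases hP with ⟨f, rfl⟩ | ⟨i, rfl⟩
        · exact fun p => ⟨C f * p, normalOrder_C_mul f p⟩
        · exact h1 i
      | algebraMap c => exact fun p => ⟨c • p, by rw [map_smul, Algebra.smul_def]⟩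
      | add P Q _ _ hP hQ =>
        intro p
        obtain ⟨p', hp'⟩ := hP p
        obtain ⟨q', hq'⟩ := hQ p
        exact ⟨p' + q', by rw [map_add, hp', hq', add_mul]⟩
      | mul P Q _ _ hP hQ =>
        intro p
        obtain ⟨q, hq⟩ := hQ p
        obtain ⟨r, hr⟩ := hP q
        exact ⟨r, by rw [hr, hq, mul_assoc]⟩
    intro P hP
    obtain ⟨q, hq⟩ := h2 P hP (C 1)
    refine ⟨q, ?_⟩
    rw [hq, normalOrder_C]
    exact LinearMap.ext fun u => by simp [mulOp]

/-- The total symbol: a differential operator `∑ f_α ∂^α` is sent to `∑ f_α ξ^α`. -/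
noncomputable def totalSymbol (N : ℕ) : D N ≃ₗ[ℂ] Gr N :=
  (LinearEquiv.ofInjective (normalOrder N) (normalOrder_injective N) |>.trans <|
    (LinearEquiv.ofEq _ _ (range_normalOrder N)).trans <|
    ({ Equiv.refl (D N) with
        map_add' := fun _ _ => rfl
        map_smul' := fun _ _ => rfl } : weylAlgebra N ≃ₗ[ℂ] D N)).symm

theorem toOp_totalSymbol_symm {N : ℕ} (p : Gr N) :
    toOp N ((totalSymbol N).symm p) = normalOrder N p := rfl

/-- The order of a differential operator (with order `0` for the zero operator). -/
noncomputable def order {N : ℕ} (P : D N) : ℕ := (totalSymbol N P).totalDegree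

/-- `F_k D`, the operators of order at most `k`. -/
def orderFiltration (N k : ℕ) : Set (D N) := {P | order P ≤ k}

/-- The (principal) symbol `σ(P)`: the part of degree `order P` of the total symbol. -/
noncomputable def symbol {N : ℕ} (P : D N) : Gr N :=
  homogeneousComponent (order P) (totalSymbol N P)

/-- For a left ideal `I` of `D`, the ideal `σ(I)` generated by the symbols of its elements. -/
noncomputable def symbolIdeal {N : ℕ} (I : Submodule (D N) (D N)) : Ideal (Gr N) :=
  Ideal.span (symbol '' (I : Set (D N)))

/-- The left ideal generated by a list of operators. -/
noncomputable def leftIdeal {N : ℕ} (rs : List (D N)) : Submodule (D N) (D N) :=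
  Submodule.span (D N) {P | P ∈ rs}

/-- `rs` is an involutive basis of the left ideal `I`: it generates `I` and the symbols of its
members generate `σ(I)`. -/
def IsInvolutiveBasis {N : ℕ} (rs : List (D N)) (I : Submodule (D N) (D N)) : Prop :=
  leftIdeal rs = I ∧ Ideal.ofList (rs.map symbol) = symbolIdeal I

/-! ### Holonomic modules -/

section Holonomic

variable {N : ℕ} {M : Type*} [AddCommGroup M] [Module (D N) M]

/-- A good filtration `F_0 ⊆ F_1 ⊆ …` of a left `D`-module (with `F_j = 0` for `j < 0`). -/
structure IsGoodFiltration (F : ℕ → AddSubgroup M) : Prop where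
  mono : Monotone F
  exhaustive : ∀ u : M, ∃ j, u ∈ F j
  smul_mem : ∀ i j, ∀ P ∈ orderFiltration N i, ∀ u ∈ F j, P • u ∈ F (i + j)
  /-- each `F_j` is finitely generated over `ℂ[x]` -/
  finite : ∀ j, ∃ S : Finset M,
    F j = AddSubgroup.closure {u | ∃ f : PolyRing N, ∃ v ∈ S, u = (ofPoly f : D N) • v}
  /-- `F_i D · F_j M = F_{i+j} M` for all `i` and all large `j` -/
  generated : ∃ j₀, ∀ j, j₀ ≤ j → ∀ i,
    F (i + j) = AddSubgroup.closure {u | ∃ P ∈ orderFiltration N i, ∃ v ∈ F j, u = P • v}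

/-- The filtration shifted by one step: `F_{j-1}`, with `F_{-1} = 0`. -/
def prevStep (F : ℕ → AddSubgroup M) : ℕ → AddSubgroup M
  | 0 => ⊥
  | j + 1 => F j

variable (N) in
/-- The annihilator in `ℂ[x][ξ]` of the graded module `⊕ F_j / F_{j-1}`. It is generated by its
homogeneous elements, and a homogeneous `p = σ_k(P)` of degree `k` kills the graded module iff
`P F_j ⊆ F_{j+k-1}` for all `j`; its zero set is the characteristic variety of `M`. -/
noncomputable def charIdeal (F : ℕ → AddSubgroup M) : Ideal (Gr N) :=
  Ideal.span {p | ∃ k, p.IsHomogeneous k ∧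
    ∀ j, ∀ u ∈ F j, (totalSymbol N).symm p • u ∈ prevStep F (j + k)}

variable (N M) in
/-- A left `D`-module on affine `N`-space is holonomic if it is finitely generated and either zero
or such that its characteristic variety, computed with a good filtration, has dimension `N`. -/
def IsHolonomic : Prop :=
  Module.Finite (D N) M ∧ (Subsingleton M ∨
    ∃ F : ℕ → AddSubgroup M, IsGoodFiltration (N := N) F ∧
      ringKrullDim (Gr N ⧸ charIdeal N F) = (N : WithBot ℕ∞))

end Holonomic

/-! ### Free divisors and the modules `N(β)` -/

/-- `Der(-log {h = 0})`, the polynomial vector fields `θ` with `θ(h) ∈ (h)`. -/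
noncomputable def derLog {N : ℕ} (h : PolyRing N) : Submodule (PolyRing N) (Derivation ℂ (PolyRing N) (PolyRing N)) where
  carrier := {θ | θ h ∈ Ideal.span {h}}
  add_mem' {θ η} hθ hη := by
    change θ h + η h ∈ Ideal.span {h}
    exact Ideal.add_mem _ hθ hη
  zero_mem' := by simp
  smul_mem' f θ hθ := by
    change f * θ h ∈ Ideal.span {h}
    exact Ideal.mul_mem_left _ f hθ

/-- The family `θ` is a basis of the `ℂ[x]`-module `Der(-log {h = 0})`. -/
def IsLogBasis {N : ℕ} (h : PolyRing N) (θ : Fin N → Derivation ℂ (PolyRing N) (PolyRing N)) : Prop :=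
  LinearIndependent (PolyRing N) θ ∧ Submodule.span (PolyRing N) (Set.range θ) = derLog h

/-- The Euler field `χ = ∑ p_i w_i ∂_{w_i}` with weights `p`. -/
noncomputable def eulerField {N : ℕ} (p : Fin N → ℚ) : Derivation ℂ (PolyRing N) (PolyRing N) :=
  mkDerivation ℂ fun i => C (p i : ℂ) * X i

/-- A polynomial in `w_1, …, w_N` as a polynomial in `w_0, w_1, …, w_N`; the new variable `w_0` has
index `0`. -/
noncomputable def extPoly {N : ℕ} (f : PolyRing N) : PolyRing (N + 1) := rename Fin.succ f

/-- A vector field in the variables `w_1, …, w_N` as a vector field in `w_0, w_1, …, w_N`. -/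
noncomputable def extDer {N : ℕ} (θ : Derivation ℂ (PolyRing N) (PolyRing N)) :
    Derivation ℂ (PolyRing (N + 1)) (PolyRing (N + 1)) :=
  mkDerivation ℂ (Fin.cons 0 fun i => extPoly (θ (X i)))

/-- `h - c w_0^d`. -/
noncomputable def hTilde {N : ℕ} (h : PolyRing N) (c : ℂ) (d : ℕ) : PolyRing (N + 1) :=
  extPoly h - C c * X 0 ^ d

/-- `χ + w_0 ∂_{w_0}`. -/
noncomputable def eulerTilde {N : ℕ} (p : Fin N → ℚ) :
    Derivation ℂ (PolyRing (N + 1)) (PolyRing (N + 1)) :=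
  extDer (eulerField p) + (X 0 : PolyRing (N + 1)) • pderiv 0

/-- The operators `h, δ_1, …, δ_m` on affine space of dimension `m + 1`. -/
noncomputable def koszulOps {m : ℕ} (h : PolyRing (m + 1))
    (δ : Fin m → Derivation ℂ (PolyRing (m + 1)) (PolyRing (m + 1))) : List (D (m + 1)) :=
  ofPoly h :: List.ofFn fun i => ofDer (δ i)

/-- The operators `h - c w_0^d, δ_1, …, δ_m, χ + w_0 ∂_{w_0} - d β`. -/
noncomputable def generators {m : ℕ} (p : Fin (m + 1) → ℚ) (d : ℕ) (h : PolyRing (m + 1))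
    (δ : Fin m → Derivation ℂ (PolyRing (m + 1)) (PolyRing (m + 1))) (c β : ℂ) : List (D (m + 2)) :=
  ofPoly (hTilde h c d) :: ((List.ofFn fun i => ofDer (extDer (δ i))) ++
    [ofDer (eulerTilde p) - algebraMap ℂ (D (m + 2)) (d * β)])

/-- The left ideal `I(β)`. -/
noncomputable def idealI {m : ℕ} (p : Fin (m + 1) → ℚ) (d : ℕ) (h : PolyRing (m + 1))
    (δ : Fin m → Derivation ℂ (PolyRing (m + 1)) (PolyRing (m + 1))) (c β : ℂ) :
    Submodule (D (m + 2)) (D (m + 2)) :=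
  leftIdeal (generators p d h δ c β)

/-- The left module `N(β) = D / I(β)`. -/
abbrev moduleN {m : ℕ} (p : Fin (m + 1) → ℚ) (d : ℕ) (h : PolyRing (m + 1))
    (δ : Fin m → Derivation ℂ (PolyRing (m + 1)) (PolyRing (m + 1))) (c β : ℂ) : Type :=
  D (m + 2) ⧸ idealI p d h δ c β

end AlgDMod

/-! Everything rests on the regularity of the symbols `h - c w_0^d, σ(δ_i), σ(χ) + w_0 ξ_0`. The
other two claims follow from it together with the Lie algebra structure of the logarithmic vector
fields.

Regularity. Strong Koszulness makes `h` a nonzerodivisor modulo every initial segment of the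
`σ(δ_i)` (`mem_spanLT_of_mul_mem`). That the `σ(δ_i)` are regular without `h` in front is not a
formal consequence, since the ring is neither local nor graded for `h`. It comes from freeness:
every `h ∂_i` is logarithmic, so after inverting `h` the symbols of a logarithmic basis are linear
coordinates in `ξ`, and `h` can be cancelled (`mem_spanLT_of_derSymbol_mul_mem`). Now adjoin `w_0`
and then `ξ_0`. Up to a unit `h - c w_0^d` is monic in `w_0`, and `σ(χ) + w_0 ξ_0` has leading
coefficient `w_0` in `ξ_0`. So it remains to see that `w_0` is a nonzerodivisor modulo `h - c w_0^d`
and the `σ(δ_i)`; setting `w_0 = 0` reduces this to `h` (`IsRegFam.adjoin_variables`). The quotient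
is nonzero because the symbols have a common zero (`span_genSymbol_ne_top`).

Involutivity. A relation among regular elements is a combination of Koszul relations. Lifted to
operators, a Koszul relation becomes a commutator of two generators, which is again a combination of
generators with coefficients of low order (`isBoundedCombination_commutator`). Hence cancellation of
leading terms in `∑ A_i P_i` can be removed by lowering the orders of the `A_i`
(`exists_lower_coefficients`), and no new symbols arise (`symbolIdeal_eq_span`).

Holonomicity. For the filtration of `D ⧸ I` induced by the order, the characteristic ideal is `σ(I)`
(`charIdeal_orderQuotientFiltration`). Here it is generated by a regular sequence of length `N` in a
polynomial ring in `2N` variables, so the quotient has dimension `N` (`ringKrullDim_gr_quotient`).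

Degrees and orders are bounded by integers, so that a bound such as `s - 1 - k i` may be negative
and then forces zero. -/

namespace AlgDMod
open MvPolynomial

/-! ### The degree filtration of the graded ring -/

/-- The polynomials in `ξ` of degree at most `s`; only `0` for `s < 0`. -/
def degLE (N : ℕ) (s : ℤ) : Submodule (PolyRing N) (Gr N) where
  carrier := {p | ∀ α : Fin N →₀ ℕ, s < α.degree → coeff α p = 0}
  add_mem' hp hq α hα := by rw [coeff_add, hp α hα, hq α hα, add_zero]
  zero_mem' _ _ := coeff_zero _
  smul_mem' f p hp α hα := by rw [coeff_smul, hp α hα, smul_zero]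

theorem mem_degLE {N : ℕ} {s : ℤ} {p : Gr N} :
    p ∈ degLE N s ↔ ∀ α : Fin N →₀ ℕ, s < α.degree → coeff α p = 0 := Iff.rfl

theorem degLE_mono {N : ℕ} {s t : ℤ} (h : s ≤ t) : degLE N s ≤ degLE N t :=
  fun _ hp α hα => hp α (h.trans_lt hα)

theorem mem_degLE_natCast {N k : ℕ} {p : Gr N} : p ∈ degLE N k ↔ p.totalDegree ≤ k := by
  rw [totalDegree, Finset.sup_le_iff, mem_degLE]
  refine forall_congr' fun α => ?_
  rw [mem_support_iff]
  change _ ↔ (coeff α p ≠ 0 → α.degree ≤ k)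
  rw [Nat.cast_lt]
  exact ⟨fun h h' => not_lt.mp fun h'' => h' (h h''),
    fun h h' => by_contra fun h'' => absurd (h h'') h'.not_ge⟩

theorem eq_zero_of_mem_degLE {N : ℕ} {s : ℤ} (hs : s < 0) {p : Gr N} (hp : p ∈ degLE N s) : p = 0 :=
  MvPolynomial.ext _ _ fun α => by rw [hp α (by omega), coeff_zero]

theorem mem_degLE_totalDegree {N : ℕ} (p : Gr N) : p ∈ degLE N p.totalDegree :=
  mem_degLE_natCast.mpr le_rfl

theorem monomial_mem_degLE {N : ℕ} {s : ℤ} {α : Fin N →₀ ℕ} (hα : (α.degree : ℤ) ≤ s) (f : PolyRing N) :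
    monomial α f ∈ degLE N s := fun β hβ => by
  classical
  rw [coeff_monomial, if_neg]
  rintro rfl
  omega

theorem mem_degLE_of_isHomogeneous {N k : ℕ} {p : Gr N} (hp : p.IsHomogeneous k) : p ∈ degLE N k :=
  fun _ hα => hp.coeff_eq_zero (by omega)

theorem degLE_induction {N : ℕ} {s : ℤ} {M : Gr N → Prop} (h0 : M 0)
    (hadd : ∀ p q, M p → M q → M (p + q))
    (hmon : ∀ (α : Fin N →₀ ℕ) (f : PolyRing N), (α.degree : ℤ) ≤ s → M (monomial α f))
    {p : Gr N} (hp : p ∈ degLE N s) : M p := by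
  rw [p.as_sum]
  refine Finset.sum_induction _ M hadd h0 fun α hα => ?_
  refine hmon α _ (not_lt.mp fun h => ?_)
  exact (mem_support_iff.mp hα) (hp α h)

theorem degree_add_single {N : ℕ} (α : Fin N →₀ ℕ) (j : Fin N) :
    (α + Finsupp.single j 1).degree = α.degree + 1 := by
  rw [map_add, Finsupp.degree_single]

theorem mul_X_mem_degLE {N : ℕ} {s : ℤ} {p : Gr N} {j : Fin N} :
    p * X j ∈ degLE N (s + 1) ↔ p ∈ degLE N s := by
  constructor
  · intro h α hα
    have := h (α + Finsupp.single j 1) (by rw [degree_add_single]; push_cast; omega)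
    rwa [coeff_mul_X] at this
  · intro h α hα
    classical
    rw [coeff_mul_X']
    split_ifs with hj
    · apply h
      have h1 : α - Finsupp.single j 1 + Finsupp.single j 1 = α := by
        apply tsub_add_cancel_of_le
        rw [Finsupp.single_le_iff]
        exact Nat.one_le_iff_ne_zero.mpr (Finsupp.mem_support_iff.mp hj)
      rw [← h1, degree_add_single] at hα
      push_cast at hα
      omega
    · rfl

theorem mul_mem_degLE {N : ℕ} {s t : ℤ} {p q : Gr N} (hp : p ∈ degLE N s) (hq : q ∈ degLE N t) :
    p * q ∈ degLE N (s + t) := by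
  refine degLE_induction (M := fun p => p * q ∈ degLE N (s + t)) (by simp)
    (fun p p' h h' => by rw [add_mul]; exact add_mem h h') (fun α f hα => ?_) hp
  refine degLE_induction (M := fun q => monomial α f * q ∈ degLE N (s + t)) (by simp)
    (fun p p' h h' => by rw [mul_add]; exact add_mem h h') (fun β g hβ => ?_) hq
  rw [monomial_mul]
  apply monomial_mem_degLE
  rw [map_add]
  push_cast
  omega

/-! ### Homogeneous components indexed by integers -/

/-- The component of degree `s` in `ξ`; zero for `s < 0`. -/
noncomputable def degComp (N : ℕ) (s : ℤ) : Gr N →ₗ[PolyRing N] Gr N :=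
  if 0 ≤ s then homogeneousComponent s.toNat else 0

theorem coeff_degComp {N : ℕ} (s : ℤ) (p : Gr N) (α : Fin N →₀ ℕ) :
    coeff α (degComp N s p) = if (α.degree : ℤ) = s then coeff α p else 0 := by
  rw [degComp]
  split_ifs with h1 h2 h2
  · rw [coeff_homogeneousComponent, if_pos (by omega)]
  · rw [coeff_homogeneousComponent, if_neg (by omega)]
  · omega
  · simp

theorem degComp_natCast {N k : ℕ} (p : Gr N) : degComp N k p = homogeneousComponent k p := by
  simp [degComp]

theorem degComp_of_isHomogeneous {N k : ℕ} {p : Gr N} (hp : p.IsHomogeneous k) (s : ℤ) :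
    degComp N s p = if s = k then p else 0 := by
  ext1 α
  rw [coeff_degComp]
  split_ifs with h1 h2 h2
  · rfl
  · exact hp.coeff_eq_zero (by omega)
  · exact (hp.coeff_eq_zero (by omega)).symm
  · simp

theorem degComp_eq_zero_of_mem {N : ℕ} {s : ℤ} {p : Gr N} (hp : p ∈ degLE N (s - 1)) :
    degComp N s p = 0 := by
  ext1 α
  rw [coeff_degComp, coeff_zero]
  split_ifs with h
  · exact hp α (by omega)
  · rfl

theorem degComp_mem {N : ℕ} (s : ℤ) (p : Gr N) : degComp N s p ∈ degLE N s := fun α hα => by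
  rw [coeff_degComp, if_neg (by omega)]

theorem degComp_idem {N : ℕ} (s : ℤ) (p : Gr N) : degComp N s (degComp N s p) = degComp N s p := by
  ext1 α
  simp only [coeff_degComp]
  split_ifs <;> rfl

theorem sub_degComp_mem {N : ℕ} {s : ℤ} {p : Gr N} (hp : p ∈ degLE N s) :
    p - degComp N s p ∈ degLE N (s - 1) := fun α hα => by
  rw [coeff_sub, coeff_degComp]
  split_ifs with h
  · rw [sub_self]
  · rw [hp α (by omega), sub_zero]

theorem degComp_mul {N k : ℕ} (s : ℤ) (p : Gr N) {q : Gr N} (hq : q.IsHomogeneous k) :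
    degComp N s (p * q) = degComp N (s - k) p * q := by
  induction p using MvPolynomial.induction_on' with
  | monomial α f =>
    have h1 : (monomial α f : Gr N).IsHomogeneous α.degree := isHomogeneous_monomial f rfl
    rw [degComp_of_isHomogeneous (h1.mul hq), degComp_of_isHomogeneous h1]
    push_cast
    by_cases h : s = α.degree + k
    · rw [if_pos h, if_pos (by omega)]
    · rw [if_neg h, if_neg (by omega), zero_mul]
  | add p p' hp hp' => rw [add_mul, map_add, hp, hp', map_add, add_mul]

theorem mul_sub_degComp_mul_mem {N k : ℕ} {s : ℤ} {p q σ : Gr N} (hp : p ∈ degLE N (s - k))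
    (hσ : σ.IsHomogeneous k) (hq : q - σ ∈ degLE N (k - 1)) :
    p * q - degComp N (s - k) p * σ ∈ degLE N (s - 1) := by
  have h1 : p * q - degComp N (s - k) p * σ = p * (q - σ) + (p - degComp N (s - k) p) * σ := by ring
  rw [h1]
  refine add_mem ?_ ?_
  · have := mul_mem_degLE hp hq
    exact degLE_mono (by omega) this
  · have := mul_mem_degLE (sub_degComp_mem hp) (mem_degLE_of_isHomogeneous hσ)
    exact degLE_mono (by omega) this

/-! ### The total symbol of a product -/

theorem normalOrder_totalSymbol {N : ℕ} (P : D N) : normalOrder N (totalSymbol N P) = toOp N P := by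
  rw [← toOp_totalSymbol_symm, LinearEquiv.symm_apply_apply]

theorem toOp_injective (N : ℕ) : Function.Injective (toOp N) := Subtype.val_injective

theorem totalSymbol_eq_iff {N : ℕ} {P : D N} {p : Gr N} :
    totalSymbol N P = p ↔ toOp N P = normalOrder N p := by
  rw [← normalOrder_totalSymbol, (normalOrder_injective N).eq_iff]

/-- The Leibniz rule: passing `∂_j` to the right of the coefficients leaves a term in which only the
coefficients are differentiated, so the degree in `ξ` does not grow. -/
theorem exists_partialOp_mul_normalOrder {N : ℕ} (j : Fin N) (q : Gr N) :
    ∃ q' : Gr N, (∀ α, coeff α q' = pderiv j (coeff α q)) ∧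
      partialOp j * normalOrder N q = normalOrder N (q * X j + q') := by
  induction q using MvPolynomial.induction_on with
  | C f =>
    refine ⟨C (pderiv j f), fun α => ?_, ?_⟩
    · classical
      rw [coeff_C, coeff_C]
      split_ifs <;> simp
    · rw [map_add, normalOrder_mul_X, normalOrder_C, normalOrder_C]
      exact LinearMap.ext fun u => by simp [mulOp, partialOp]; ring
  | add p q hp hq =>
    obtain ⟨p', h1, h2⟩ := hp
    obtain ⟨q', h3, h4⟩ := hq
    refine ⟨p' + q', fun α => by rw [coeff_add, coeff_add, h1, h3, map_add], ?_⟩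
    rw [map_add, mul_add, h2, h4, ← map_add]
    congr 1
    ring
  | mul_X p i hp =>
    obtain ⟨p', h1, h2⟩ := hp
    refine ⟨p' * X i, fun α => ?_, ?_⟩
    · classical
      rw [coeff_mul_X', coeff_mul_X', h1]
      split_ifs <;> simp
    · rw [normalOrder_mul_X, ← mul_assoc, h2, ← normalOrder_mul_X]
      congr 1
      ring

theorem exists_normalOrder_mul {N : ℕ} {s t : ℤ} {p q : Gr N} (hp : p ∈ degLE N s)
    (hq : q ∈ degLE N t) :
    ∃ r ∈ degLE N (s + t - 1), normalOrder N p * normalOrder N q = normalOrder N (p * q + r) := by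
  refine degLE_induction (M := fun p => ∃ r ∈ degLE N (s + t - 1),
    normalOrder N p * normalOrder N q = normalOrder N (p * q + r)) ⟨0, zero_mem _, by simp⟩ ?_ (fun α f hα => ?_) hp
  · rintro p p' ⟨r, hr, h⟩ ⟨r', hr', h'⟩
    refine ⟨r + r', add_mem hr hr', ?_⟩
    rw [map_add, add_mul, h, h', ← map_add]
    congr 1
    ring
  -- Peeling the last `∂_j` off the left factor changes the right factor to `q ξ_j` and to `q'`, so
  -- the induction must range over all `q` and both degree bounds.
  · have key : ∀ (s t : ℤ) (q : Gr N), monomial α f ∈ degLE N s → q ∈ degLE N t →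
        ∃ r ∈ degLE N (s + t - 1),
          normalOrder N (monomial α f) * normalOrder N q = normalOrder N (monomial α f * q + r) := by
      refine MvPolynomial.induction_on_monomial (motive := fun p => ∀ (s t : ℤ) (q : Gr N),
        p ∈ degLE N s → q ∈ degLE N t → ∃ r ∈ degLE N (s + t - 1),
          normalOrder N p * normalOrder N q = normalOrder N (p * q + r)) ?_ ?_ α f
      · intro f s t q _ _
        exact ⟨0, zero_mem _, by rw [add_zero, normalOrder_C_mul, normalOrder_C]⟩
      · intro p j ih s t q hp hq
        obtain ⟨q', h1, h2⟩ := exists_partialOp_mul_normalOrder j q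
        have hq' : q' ∈ degLE N t := fun α hα => by rw [h1, hq α hα, map_zero]
        have hp' : p ∈ degLE N (s - 1) := by
          rw [← mul_X_mem_degLE (j := j), sub_add_cancel]
          exact hp
        obtain ⟨r, hr, h3⟩ := ih (s - 1) (t + 1) (q * X j) hp' (mul_X_mem_degLE.mpr hq)
        obtain ⟨r', hr', h4⟩ := ih (s - 1) t q' hp' hq'
        refine ⟨r + (p * q' + r'), add_mem (degLE_mono (by omega) hr) (add_mem ?_ ?_), ?_⟩
        · exact degLE_mono (by omega) (mul_mem_degLE hp' hq')
        · exact degLE_mono (by omega) hr'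
        · rw [normalOrder_mul_X, mul_assoc, h2, map_add, mul_add, h3, h4, ← map_add]
          congr 1
          ring
    exact key s t q (monomial_mem_degLE hα f) hq

/-- The operators of order at most `s`; only `0` for `s < 0`. -/
noncomputable def ordLE (N : ℕ) (s : ℤ) : Submodule ℂ (D N) :=
  ((degLE N s).restrictScalars ℂ).comap (totalSymbol N : D N →ₗ[ℂ] Gr N)

theorem mem_ordLE {N : ℕ} {s : ℤ} {P : D N} : P ∈ ordLE N s ↔ totalSymbol N P ∈ degLE N s := Iff.rfl

theorem mem_orderFiltration {N k : ℕ} {P : D N} : P ∈ orderFiltration N k ↔ P ∈ ordLE N k :=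
  mem_degLE_natCast.symm

theorem ordLE_mono {N : ℕ} {s t : ℤ} (h : s ≤ t) : ordLE N s ≤ ordLE N t :=
  fun _ hP => degLE_mono h hP

theorem symm_mem_ordLE {N : ℕ} {s : ℤ} {p : Gr N} : (totalSymbol N).symm p ∈ ordLE N s ↔ p ∈ degLE N s := by
  rw [mem_ordLE, LinearEquiv.apply_symm_apply]

theorem totalSymbol_mul_sub_mem {N : ℕ} {s t : ℤ} {P Q : D N} (hP : P ∈ ordLE N s) (hQ : Q ∈ ordLE N t) :
    totalSymbol N (P * Q) - totalSymbol N P * totalSymbol N Q ∈ degLE N (s + t - 1) := by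
  obtain ⟨r, hr, h⟩ := exists_normalOrder_mul (mem_ordLE.mp hP) (mem_ordLE.mp hQ)
  have h1 : totalSymbol N (P * Q) = totalSymbol N P * totalSymbol N Q + r := by
    rw [totalSymbol_eq_iff, map_mul, ← h, normalOrder_totalSymbol, normalOrder_totalSymbol]
  rw [h1, add_sub_cancel_left]
  exact hr

theorem mul_mem_ordLE {N : ℕ} {s t : ℤ} {P Q : D N} (hP : P ∈ ordLE N s) (hQ : Q ∈ ordLE N t) :
    P * Q ∈ ordLE N (s + t) := by
  have h := add_mem (degLE_mono (sub_one_lt _).le (totalSymbol_mul_sub_mem hP hQ)) (mul_mem_degLE (mem_ordLE.mp hP) (mem_ordLE.mp hQ))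
  rwa [sub_add_cancel] at h

/-- The graded ring is commutative, so the products of total symbols cancel. -/
theorem commutator_mem_ordLE {N : ℕ} {s t : ℤ} {P Q : D N} (hP : P ∈ ordLE N s) (hQ : Q ∈ ordLE N t) :
    P * Q - Q * P ∈ ordLE N (s + t - 1) := by
  have h1 := totalSymbol_mul_sub_mem hP hQ
  have h2 := totalSymbol_mul_sub_mem hQ hP
  rw [add_comm t s] at h2
  have h := sub_mem h1 h2
  rw [mem_ordLE, map_sub]
  convert h using 1
  ring

theorem symbol_eq_degComp {N : ℕ} (P : D N) : symbol P = degComp N (order P) (totalSymbol N P) :=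
  (degComp_natCast _).symm

/-- If `σ = 0`, the order of `P` could drop below `k` and its symbol be nonzero; `h0` excludes this.
-/
theorem symbol_eq_of_sub_mem {N k : ℕ} {P : D N} {σ : Gr N} (hσ : σ.IsHomogeneous k)
    (h : totalSymbol N P - σ ∈ degLE N (k - 1)) (h0 : σ = 0 → P = 0) : symbol P = σ := by
  by_cases hz : σ = 0
  · rw [h0 hz, hz, symbol, map_zero, map_zero]
  have hP : totalSymbol N P ∈ degLE N k := by
    have := add_mem (degLE_mono (sub_one_lt _).le h) (mem_degLE_of_isHomogeneous hσ)
    rwa [sub_add_cancel] at this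
  have hc : degComp N k (totalSymbol N P) = σ := by
    have := degComp_eq_zero_of_mem h
    rwa [map_sub, degComp_of_isHomogeneous hσ, if_pos rfl, sub_eq_zero] at this
  have ho : order P = k := by
    refine le_antisymm (mem_degLE_natCast.mp hP) (not_lt.mp fun hlt => hz ?_)
    rw [← hc]
    refine degComp_eq_zero_of_mem (degLE_mono ?_ (mem_degLE_totalDegree _))
    have : (order P : ℤ) < k := by exact_mod_cast hlt
    change (order P : ℤ) ≤ k - 1
    omega
  rw [symbol_eq_degComp, ho, hc]

/-! ### Regular families -/

/-- The ideal generated by `I` and the members of `s` with index less than `t`. -/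
def spanLT {R : Type*} [CommRing R] {r : ℕ} (I : Ideal R) (s : Fin r → R) (t : ℕ) : Ideal R :=
  I ⊔ Ideal.span (s '' {j | (j : ℕ) < t})

/-- The family `s` is weakly regular on `R ⧸ I`. -/
def IsRegFam {R : Type*} [CommRing R] {r : ℕ} (I : Ideal R) (s : Fin r → R) : Prop :=
  ∀ (i : Fin r) (f : R), s i * f ∈ spanLT I s i → f ∈ spanLT I s i

theorem mem_span_image_iff {R : Type*} [CommRing R] {r : ℕ} {s : Fin r → R} {S : Set (Fin r)} {a : R} :
    a ∈ Ideal.span (s '' S) ↔ ∃ b : Fin r → R, (∀ j, j ∉ S → b j = 0) ∧ a = ∑ j, b j * s j := by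
  constructor
  · intro h
    induction h using Submodule.span_induction with
    | mem x hx =>
      obtain ⟨i, hi, rfl⟩ := hx
      refine ⟨Pi.single i 1, fun j hj => Pi.single_eq_of_ne (by rintro rfl; exact hj hi) _, ?_⟩
      rw [Finset.sum_eq_single i] <;> simp +contextual
    | zero => exact ⟨0, by simp⟩
    | add x y _ _ hx hy =>
      obtain ⟨b, hb, rfl⟩ := hx
      obtain ⟨b', hb', rfl⟩ := hy
      refine ⟨b + b', fun j hj => by simp [hb j hj, hb' j hj], ?_⟩
      simp [add_mul, Finset.sum_add_distrib]
    | smul c x _ hx =>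
      obtain ⟨b, hb, rfl⟩ := hx
      refine ⟨fun j => c * b j, fun j hj => by simp [hb j hj], ?_⟩
      simp [Finset.mul_sum, mul_assoc]
  · rintro ⟨b, hb, rfl⟩
    refine Ideal.sum_mem _ fun j _ => ?_
    by_cases hj : j ∈ S
    · exact Ideal.mul_mem_left _ _ (Ideal.subset_span ⟨j, hj, rfl⟩)
    · rw [hb j hj, zero_mul]
      exact zero_mem _

theorem spanLT_bot {R : Type*} [CommRing R] {r : ℕ} (s : Fin r → R) (t : ℕ) :
    spanLT ⊥ s t = Ideal.span (s '' {j | (j : ℕ) < t}) := bot_sup_eq _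

/-! ### Left ideals generated by operators with regular symbols -/

theorem mem_span_range_iff {R : Type*} [Ring R] {r : ℕ} {P : Fin r → R} {x : R} :
    x ∈ Submodule.span R (Set.range P) ↔ ∃ A : Fin r → R, x = ∑ i, A i * P i := by
  rw [Submodule.mem_span_range_iff_exists_fun]
  simp only [smul_eq_mul, eq_comm]

section Involutive

variable {N r : ℕ} {P : Fin r → D N} {σ : Fin r → Gr N} {k : Fin r → ℕ}

/-- Since the `σ j` are homogeneous, arbitrary coefficients may be replaced by their components of
degree `e - k j`, which are zero when this is negative. -/
theorem exists_homogeneous_combination (hσ : ∀ i, (σ i).IsHomogeneous (k i)) {e : ℤ} {a : Gr N}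
    (ha : degComp N e a = a) {t : ℕ} (h : a ∈ Ideal.span (σ '' {j | (j : ℕ) < t})) :
    ∃ b : Fin r → Gr N, (∀ j, b j ∈ degLE N (e - k j)) ∧ (∀ j : Fin r, t ≤ j → b j = 0) ∧
      a = ∑ j, b j * σ j := by
  obtain ⟨b, hb, h⟩ := mem_span_image_iff.mp h
  refine ⟨fun j => degComp N (e - k j) (b j), fun j => degComp_mem _ _,
    fun j hj => by simp only [hb j (by simpa using hj), map_zero], ?_⟩
  rw [← ha, h, map_sum]
  exact Finset.sum_congr rfl fun j _ => degComp_mul _ _ (hσ j)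

theorem totalSymbol_sum_sub_mem (hσ : ∀ i, (σ i).IsHomogeneous (k i))
    (hP : ∀ i, totalSymbol N (P i) - σ i ∈ degLE N (k i - 1)) {s : ℤ} {A : Fin r → D N}
    (hA : ∀ i, A i ∈ ordLE N (s - k i)) :
    totalSymbol N (∑ i, A i * P i) - ∑ i, degComp N (s - k i) (totalSymbol N (A i)) * σ i ∈
      degLE N (s - 1) := by
  rw [map_sum, ← Finset.sum_sub_distrib]
  refine sum_mem fun i _ => ?_
  have hPi : P i ∈ ordLE N (k i) := by
    have := add_mem (degLE_mono (sub_one_lt _).le (hP i)) (mem_degLE_of_isHomogeneous (hσ i))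
    rwa [sub_add_cancel] at this
  have h1 := totalSymbol_mul_sub_mem (hA i) hPi
  rw [sub_add_cancel] at h1
  have h2 := mul_sub_degComp_mul_mem (mem_ordLE.mp (hA i)) (hσ i) (hP i)
  have := add_mem h1 h2
  rwa [sub_add_sub_cancel] at this

/-- The leading parts of the `A i` form a syzygy of the `σ i`. Its last possibly nonzero entry, at
`τ`, lies by regularity in the ideal of the earlier `σ j`. Subtracting the lifted Koszul syzygies
lowers `A τ`, at the price of commutators absorbed by `hcomm`. The induction on `t` moves the bound
below which coefficients may still be too large down to zero. -/
theorem exists_lower_coefficients (hσ : ∀ i, (σ i).IsHomogeneous (k i))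
    (hP : ∀ i, totalSymbol N (P i) - σ i ∈ degLE N (k i - 1)) (hreg : IsRegFam ⊥ σ)
    (hcomm : ∀ i j, ∃ A : Fin r → D N, (∀ l, A l ∈ ordLE N (k i + k j - 1 - k l)) ∧
      P i * P j - P j * P i = ∑ l, A l * P l) {s : ℤ} (t : ℕ) (A : Fin r → D N)
    (hA : ∀ i, A i ∈ ordLE N (s - k i)) (ht : ∀ i : Fin r, t ≤ i → A i ∈ ordLE N (s - 1 - k i))
    (hsum : ∑ i, A i * P i ∈ ordLE N (s - 1)) :
    ∃ A' : Fin r → D N, (∀ i, A' i ∈ ordLE N (s - 1 - k i)) ∧ ∑ i, A' i * P i = ∑ i, A i * P i := by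
  induction t generalizing A with
  | zero => exact ⟨A, fun i => ht i (Nat.zero_le _), rfl⟩
  | succ t ih =>
    by_cases htr : r ≤ t
    · exact ih A hA (fun i hi => absurd (i.2.trans_le htr) hi.not_gt) hsum
    push Not at htr
    obtain ⟨τ, hτ⟩ : ∃ τ : Fin r, (τ : ℕ) = t := ⟨⟨t, htr⟩, rfl⟩
    subst hτ
    have hPk : ∀ i, P i ∈ ordLE N (k i) := fun i => by
      have := add_mem (degLE_mono (sub_one_lt _).le (hP i)) (mem_degLE_of_isHomogeneous (hσ i))
      rwa [sub_add_cancel] at this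
    set a : Fin r → Gr N := fun i => degComp N (s - k i) (totalSymbol N (A i)) with ha
    -- The total has order at most `s - 1`, so its part of degree `s` vanishes.
    have hsum0 : ∑ i, a i * σ i = 0 := by
      have h1 := sub_mem (mem_ordLE.mp hsum) (totalSymbol_sum_sub_mem hσ hP hA)
      rw [sub_sub_cancel] at h1
      have h2 := degComp_eq_zero_of_mem h1
      rw [map_sum] at h2
      rw [← h2]
      refine Finset.sum_congr rfl fun i _ => ?_
      rw [degComp_mul _ _ (hσ i), degComp_idem]
    have ha0 : ∀ i : Fin r, τ < i → a i = 0 := fun i hi => by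
      refine degComp_eq_zero_of_mem ?_
      have := mem_ordLE.mp (ht i hi)
      exact degLE_mono (by omega) this
    have hmem : σ τ * a τ ∈ spanLT ⊥ σ τ := by
      have h1 : σ τ * a τ = -∑ i ∈ Finset.univ.erase τ, a i * σ i := by
        rw [eq_neg_iff_add_eq_zero, mul_comm, Finset.add_sum_erase _ (fun i => a i * σ i) (Finset.mem_univ τ), hsum0]
      rw [h1, spanLT_bot]
      refine neg_mem (Ideal.sum_mem _ fun i hi => ?_)
      rcases lt_or_gt_of_ne (Finset.ne_of_mem_erase hi) with h | h
      · exact Ideal.mul_mem_left _ _ (Ideal.subset_span ⟨i, h, rfl⟩)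
      · rw [ha0 i h, zero_mul]
        exact zero_mem _
    have hmem' := hreg τ _ hmem
    rw [spanLT_bot] at hmem'
    obtain ⟨b, hb, hb0, hab⟩ := exists_homogeneous_combination hσ (degComp_idem _ _) hmem'
    choose Q hQ hQsum using hcomm
    set B : Fin r → D N := fun j => (totalSymbol N).symm (b j) with hB
    have hBmem : ∀ j, B j ∈ ordLE N (s - k τ - k j) := fun j => symm_mem_ordLE.mpr (hb j)
    -- Only indices below `τ` receive a correction `B j * P τ`, so the coefficients beyond `τ` stay
    -- low.
    have hB0 : ∀ j : Fin r, (τ : ℕ) ≤ j → B j = 0 := fun j hj => by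
      simp only [hB]
      rw [hb0 j hj, map_zero]
    have hAτ : A τ - ∑ j, B j * P j ∈ ordLE N (s - 1 - k τ) := by
      have h1 : ∀ j, degComp N (s - k τ - k j) (totalSymbol N (B j)) * σ j = degComp N (s - k τ) (b j * σ j) :=
        fun j => by
          rw [degComp_mul _ _ (hσ j)]
          simp only [hB, LinearEquiv.apply_symm_apply]
      have h2 := totalSymbol_sum_sub_mem hσ hP hBmem
      rw [Finset.sum_congr rfl fun j _ => h1 j, ← map_sum, ← hab, degComp_idem] at h2
      have h3 := sub_mem (sub_degComp_mem (hA τ)) h2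
      change _ - a τ - _ ∈ _ at h3
      rw [mem_ordLE, map_sub]
      rw [sub_sub_sub_cancel_right] at h3
      exact degLE_mono (by omega) h3
    have hlow : ∀ i, ∑ j, B j * Q j τ i ∈ ordLE N (s - 1 - k i) := fun i => by
      refine sum_mem fun j _ => ?_
      exact ordLE_mono (by omega) (mul_mem_ordLE (hBmem j) (hQ j τ i))
    -- Trade `B j * P j` in the coefficient of `P τ` for `B j * P τ` in that of `P j`; the last sum
    -- rewrites `B j * (P j * P τ - P τ * P j)`.
    let A₁ : Fin r → D N := fun i =>
      (if i = τ then A τ - ∑ j, B j * P j else A i + B i * P τ) + ∑ j, B j * Q j τ i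
    have hsum₁ : ∑ i, A₁ i * P i = ∑ i, A i * P i := by
      have h1 : ∑ i, (∑ j, B j * Q j τ i) * P i = ∑ j, B j * (P j * P τ - P τ * P j) := by
        simp only [hQsum, Finset.sum_mul, Finset.mul_sum, mul_assoc]
        exact Finset.sum_comm
      have h2 : ∀ i, (if i = τ then A τ - ∑ j, B j * P j else A i + B i * P τ) =
          A i + B i * P τ - if i = τ then ∑ j, B j * P j else 0 := by
        intro i
        split_ifs with h
        · subst h
          rw [hB0 i le_rfl, zero_mul, add_zero]
        · rw [sub_zero]
      simp only [A₁, h2, add_mul, sub_mul, Finset.sum_add_distrib, Finset.sum_sub_distrib]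
      rw [h1]
      simp only [ite_mul, zero_mul, Finset.sum_ite_eq', Finset.mem_univ, if_true, mul_sub,
        Finset.sum_sub_distrib, Finset.sum_mul, mul_assoc]
      abel
    rw [← hsum₁] at hsum ⊢
    refine ih A₁ (fun i => ?_) (fun i hi => ?_) hsum
    · refine add_mem ?_ (ordLE_mono (by omega) (hlow i))
      split_ifs with h
      · subst h
        exact ordLE_mono (by omega) hAτ
      · exact add_mem (hA i) (ordLE_mono (by omega) (mul_mem_ordLE (hBmem i) (hPk τ)))
    · refine add_mem ?_ (hlow i)
      split_ifs with h
      · subst h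
        exact hAτ
      · have hlt : (τ : ℕ) < i := lt_of_le_of_ne hi fun e => h (Fin.ext e.symm)
        rw [hB0 i hi, zero_mul, add_zero]
        exact ht i hlt

theorem symbolIdeal_eq_span (hσ : ∀ i, (σ i).IsHomogeneous (k i))
    (hP : ∀ i, totalSymbol N (P i) - σ i ∈ degLE N (k i - 1)) (hσP : ∀ i, symbol (P i) = σ i)
    (hreg : IsRegFam ⊥ σ)
    (hcomm : ∀ i j, ∃ A : Fin r → D N, (∀ l, A l ∈ ordLE N (k i + k j - 1 - k l)) ∧
      P i * P j - P j * P i = ∑ l, A l * P l) :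
    symbolIdeal (Submodule.span (D N) (Set.range P)) = Ideal.span (Set.range σ) := by
  apply le_antisymm
  · rw [symbolIdeal, Ideal.span_le]
    rintro _ ⟨x, hx, rfl⟩
    obtain ⟨A, hA⟩ := mem_span_range_iff.mp hx
    -- Here `n` measures how far the terms `A i * P i` may exceed the order of `x`. At `n = 0`
    -- nothing cancels and the symbol of `x` is read off.
    have key : ∀ (n : ℕ) (A : Fin r → D N), (∀ i, A i ∈ ordLE N (order x + n - k i)) →
        x = ∑ i, A i * P i → symbol x ∈ Ideal.span (Set.range σ) := by
      intro n
      induction n with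
      | zero =>
        intro A hA hx
        have h1 := degComp_eq_zero_of_mem (totalSymbol_sum_sub_mem hσ hP hA)
        rw [← hx, map_sub, Nat.cast_zero, add_zero, ← symbol_eq_degComp, sub_eq_zero] at h1
        rw [h1, map_sum]
        refine Ideal.sum_mem _ fun i _ => ?_
        rw [degComp_mul _ _ (hσ i)]
        exact Ideal.mul_mem_left _ _ (Ideal.subset_span ⟨i, rfl⟩)
      | succ n ih =>
        intro A hA hx
        have hx' : ∑ i, A i * P i ∈ ordLE N (order x + (n + 1 : ℕ) - 1) := by
          rw [← hx]
          refine degLE_mono ?_ (mem_degLE_totalDegree _)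
          change (order x : ℤ) ≤ _
          push_cast
          omega
        obtain ⟨A', hA', hs⟩ := exists_lower_coefficients hσ hP hreg hcomm r A hA
          (fun i hi => absurd i.2 hi.not_gt) hx'
        refine ih A' (fun i => ordLE_mono (by push_cast; omega) (hA' i)) (by rw [hs, ← hx])
    refine key (∑ i, (order (A i) + k i)) A (fun i => ?_) hA
    have h1 : order (A i) + k i ≤ ∑ i, (order (A i) + k i) :=
      Finset.single_le_sum (f := fun i => order (A i) + k i) (fun _ _ => Nat.zero_le _) (Finset.mem_univ i)
    refine degLE_mono ?_ (mem_degLE_totalDegree (totalSymbol N (A i)))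
    change (order (A i) : ℤ) ≤ _
    omega
  · rw [Ideal.span_le]
    rintro _ ⟨i, rfl⟩
    rw [← hσP]
    exact Ideal.subset_span ⟨P i, Submodule.subset_span ⟨i, rfl⟩, rfl⟩

end Involutive

/-! ### Exchange properties of regular families, and comparison with regular sequences -/

section RegularFamilies

variable {R : Type*} [CommRing R] {r : ℕ}

theorem spanLT_zero (I : Ideal R) (s : Fin r → R) : spanLT I s 0 = I := by
  simp [spanLT]

theorem spanLT_succ (I : Ideal R) (s : Fin r → R) (i : Fin r) :
    spanLT I s (i + 1) = spanLT I s i ⊔ Ideal.span {s i} := by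
  rw [spanLT, spanLT, sup_assoc, ← Ideal.span_union, ← Set.image_singleton, ← Set.image_union]
  congr 3
  ext j
  simp only [Set.mem_ofPred_eq, Set.mem_union, Set.mem_singleton_iff, Fin.ext_iff]
  omega

theorem spanLT_of_le (I : Ideal R) (s : Fin r → R) {t : ℕ} (h : r ≤ t) :
    spanLT I s t = I ⊔ Ideal.span (Set.range s) := by
  rw [spanLT, ← Set.image_univ]
  congr 3
  ext j
  simp only [Set.mem_ofPred_eq, Set.mem_univ, iff_true]
  omega

theorem spanLT_sup (I K : Ideal R) (s : Fin r → R) (t : ℕ) :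
    spanLT (I ⊔ K) s t = spanLT I s t ⊔ K :=
  sup_right_comm _ _ _

theorem spanLT_cons (I : Ideal R) (a : R) (s : Fin r → R) (t : ℕ) :
    spanLT I (Fin.cons a s : Fin (r + 1) → R) (t + 1) = spanLT (I ⊔ Ideal.span {a}) s t := by
  rw [spanLT, spanLT, sup_assoc, ← Ideal.span_union]
  congr 2
  ext x
  simp only [Set.mem_image, Set.mem_ofPred_eq, Set.mem_union, Set.mem_singleton_iff, Fin.exists_fin_succ,
    Fin.cons_zero, Fin.cons_succ, Fin.val_succ, Fin.val_zero, Nat.add_lt_add_iff_right,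
    Nat.succ_pos, true_and, eq_comm (a := a)]

theorem spanLT_snoc (I : Ideal R) (a : R) (s : Fin r → R) {t : ℕ} (h : t ≤ r) :
    spanLT I (Fin.snoc s a : Fin (r + 1) → R) t = spanLT I s t := by
  rw [spanLT, spanLT]
  congr 2
  ext x
  simp only [Set.mem_image, Set.mem_ofPred_eq, Fin.exists_fin_succ', Fin.snoc_castSucc, Fin.snoc_last,
    Fin.val_castSucc, Fin.val_last, h.not_gt, false_and, or_false]

theorem isRegFam_cons_iff {I : Ideal R} {a : R} {s : Fin r → R} :
    IsRegFam I (Fin.cons a s : Fin (r + 1) → R) ↔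
      (∀ f, a * f ∈ I → f ∈ I) ∧ IsRegFam (I ⊔ Ideal.span {a}) s := by
  rw [IsRegFam, Fin.forall_fin_succ]
  simp only [Fin.val_zero, spanLT_zero, Fin.cons_zero, Fin.val_succ, spanLT_cons, Fin.cons_succ, IsRegFam]

theorem IsRegFam.snoc {I : Ideal R} {a : R} {s : Fin r → R} (hs : IsRegFam I s)
    (ha : ∀ f, a * f ∈ spanLT I s r → f ∈ spanLT I s r) :
    IsRegFam I (Fin.snoc s a : Fin (r + 1) → R) := by
  intro i
  induction i using Fin.lastCases with
  | last => rw [Fin.snoc_last, Fin.val_last, spanLT_snoc _ _ _ le_rfl]; exact ha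
  | cast i => rw [Fin.snoc_castSucc, Fin.val_castSucc, spanLT_snoc _ _ _ i.2.le]; exact hs i

theorem mem_sup_span_singleton_iff {I : Ideal R} {a x : R} :
    x ∈ I ⊔ Ideal.span {a} ↔ ∃ b, x - b * a ∈ I := by
  rw [Submodule.mem_sup]
  constructor
  · rintro ⟨y, hy, z, hz, rfl⟩
    obtain ⟨b, rfl⟩ := Ideal.mem_span_singleton'.mp hz
    exact ⟨b, by rwa [add_sub_cancel_right]⟩
  · rintro ⟨b, hb⟩
    exact ⟨_, hb, _, Ideal.mem_span_singleton'.mpr ⟨b, rfl⟩, sub_add_cancel _ _⟩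

/-- Half of the exchange of `a` with `s`, valid in any commutative ring. From `a f ≡ b s_τ`,
regularity modulo `a` gives `b ≡ g a`, so `a (f - g s_τ)` lies in the previous ideal and induction
applies. -/
theorem mem_spanLT_of_mul_mem {I : Ideal R} {a : R} {s : Fin r → R} (ha : ∀ f, a * f ∈ I → f ∈ I)
    (hs : IsRegFam (I ⊔ Ideal.span {a}) s) (t : ℕ) :
    ∀ f, a * f ∈ spanLT I s t → f ∈ spanLT I s t := by
  induction t with
  | zero => rwa [spanLT_zero]
  | succ t ih =>
    by_cases htr : r ≤ t
    · rwa [spanLT_of_le _ _ (htr.trans t.le_succ), ← spanLT_of_le _ _ htr]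
    obtain ⟨τ, rfl⟩ : ∃ τ : Fin r, (τ : ℕ) = t := ⟨⟨t, not_le.mp htr⟩, rfl⟩
    intro f hf
    rw [spanLT_succ, mem_sup_span_singleton_iff] at hf ⊢
    obtain ⟨b, hb⟩ := hf
    have h1 : s τ * b ∈ spanLT (I ⊔ Ideal.span {a}) s τ := by
      rw [spanLT_sup, mem_sup_span_singleton_iff]
      refine ⟨f, ?_⟩
      convert neg_mem hb using 1
      ring
    have h2 := hs τ b h1
    rw [spanLT_sup, mem_sup_span_singleton_iff] at h2
    obtain ⟨g, hg⟩ := h2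
    refine ⟨g, ih _ ?_⟩
    convert add_mem hb (Ideal.mul_mem_right (s τ) _ hg) using 1
    ring

/-- The opposite exchange: from `s_i f ≡ g a`, cancelling `a` gives `g ≡ g' s_i`, and then `s_i`
cancels from `s_i (f - g' a)`. -/
theorem IsRegFam.sup_span_singleton {I : Ideal R} {a : R} {s : Fin r → R} (hs : IsRegFam I s)
    (ha : ∀ t f, a * f ∈ spanLT I s t → f ∈ spanLT I s t) :
    IsRegFam (I ⊔ Ideal.span {a}) s := by
  intro i f hf
  rw [spanLT_sup, mem_sup_span_singleton_iff] at hf ⊢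
  obtain ⟨g, hg⟩ := hf
  have h1 : a * g ∈ spanLT I s (i + 1) := by
    rw [spanLT_succ, mem_sup_span_singleton_iff]
    refine ⟨f, ?_⟩
    convert neg_mem hg using 1
    ring
  have h2 := ha _ _ h1
  rw [spanLT_succ, mem_sup_span_singleton_iff] at h2
  obtain ⟨g', hg'⟩ := h2
  refine ⟨g', hs i _ ?_⟩
  convert add_mem hg (Ideal.mul_mem_right a _ hg') using 1
  ring

theorem ofList_take_ofFn (s : Fin r → R) (t : ℕ) :
    Ideal.ofList ((List.ofFn s).take t) = spanLT ⊥ s t := by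
  rw [spanLT_bot, Ideal.ofList]
  congr 1
  ext x
  simp only [Set.mem_ofPred_eq, List.mem_take_iff_getElem, List.getElem_ofFn, List.length_ofFn, Set.mem_image]
  constructor
  · rintro ⟨i, hi, rfl⟩
    exact ⟨⟨i, by omega⟩, by simp; omega, rfl⟩
  · rintro ⟨i, hi, rfl⟩
    exact ⟨i, by omega, rfl⟩

theorem isWeaklyRegular_ofFn_iff (s : Fin r → R) :
    RingTheory.Sequence.IsWeaklyRegular R (List.ofFn s) ↔ IsRegFam ⊥ s := by
  rw [RingTheory.Sequence.isWeaklyRegular_iff]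
  have h : ∀ (i : ℕ) (hi : i < r),
      IsSMulRegular (R ⧸ (Ideal.ofList ((List.ofFn s).take i) • ⊤ : Ideal R)) (s ⟨i, hi⟩) ↔
        ∀ f, s ⟨i, hi⟩ * f ∈ spanLT ⊥ s i → f ∈ spanLT ⊥ s i := fun i hi => by
    rw [isSMulRegular_quotient_iff_mem_of_smul_mem, ofList_take_ofFn]
    simp only [smul_eq_mul, Ideal.mul_top]
  constructor
  · intro H i
    have := H i (by simp)
    rw [List.getElem_ofFn] at this
    exact (h i i.2).mp this
  · intro H i hi
    rw [List.getElem_ofFn]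
    exact (h i (by simpa using hi)).mpr (H ⟨i, by simpa using hi⟩)

theorem isRegular_ofFn_iff (s : Fin r → R) :
    RingTheory.Sequence.IsRegular R (List.ofFn s) ↔ IsRegFam ⊥ s ∧ Ideal.span (Set.range s) ≠ ⊤ := by
  rw [RingTheory.Sequence.isRegular_iff, isWeaklyRegular_ofFn_iff, Ideal.smul_top_eq_map,
    Algebra.algebraMap_self, Ideal.map_id, Submodule.restrictScalars_self]
  have h : Ideal.ofList (List.ofFn s) = Ideal.span (Set.range s) := by
    rw [Ideal.ofList]
    congr 1
    ext x
    simp [List.mem_ofFn]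
  rw [h, ne_comm]

theorem spanLT_map {S : Type*} [CommRing S] (e : R →+* S) (I : Ideal R) (s : Fin r → R) (t : ℕ) :
    spanLT (I.map e) (fun i => e (s i)) t = (spanLT I s t).map e := by
  rw [spanLT, spanLT, Ideal.map_sup, Ideal.map_span, Set.image_image]

theorem IsRegFam.map_ringEquiv {S : Type*} [CommRing S] (e : R ≃+* S) {s : Fin r → R}
    (hs : IsRegFam ⊥ s) : IsRegFam ⊥ fun i => e (s i) := by
  intro i f hf
  have h : ∀ t, spanLT ⊥ (fun i => e (s i)) t = (spanLT ⊥ s t).map (e : R →+* S) := fun t => by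
    rw [← spanLT_map, Ideal.map_bot]
    rfl
  rw [h] at hf ⊢
  obtain ⟨g, rfl⟩ := e.surjective f
  have hmem : ∀ x, e x ∈ (spanLT ⊥ s i).map (e : R →+* S) ↔ x ∈ spanLT ⊥ s i := fun x => by
    rw [Ideal.mem_map_iff_of_surjective (e : R →+* S) e.surjective]
    exact ⟨fun ⟨y, hy, hxy⟩ => e.injective hxy ▸ hy, fun hx => ⟨x, hx, rfl⟩⟩
  rw [← map_mul, hmem] at hf
  exact (hmem g).mpr (hs i g hf)

end RegularFamilies

/-! ### Nonzerodivisors in polynomial rings -/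

section Polynomials

variable {A : Type*} [CommRing A] {r : ℕ}

/-- Over `A ⧸ I` the coefficient of degree `n` cannot kill the leading coefficient of a nonzero `q`.
-/
theorem mem_map_C_of_mul_mem {I : Ideal A} {p : Polynomial A} {n : ℕ} (hn : p.natDegree ≤ n)
    (hp : ∀ a, p.coeff n * a ∈ I → a ∈ I) {q : Polynomial A}
    (h : p * q ∈ I.map (Polynomial.C : A →+* Polynomial A)) :
    q ∈ I.map (Polynomial.C : A →+* Polynomial A) := by
  have hker : ∀ x : Polynomial A, x ∈ I.map (Polynomial.C : A →+* Polynomial A) ↔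
      x.map (Ideal.Quotient.mk I) = 0 := fun x => by
    rw [Ideal.mem_map_C_iff, Polynomial.ext_iff]
    simp only [Polynomial.coeff_map, Polynomial.coeff_zero, Ideal.Quotient.eq_zero_iff_mem]
  rw [hker] at h ⊢
  rw [Polynomial.map_mul] at h
  by_contra hq
  set Q := q.map (Ideal.Quotient.mk I) with hQ
  have h1 := Polynomial.coeff_mul_add_eq_of_natDegree_le
    ((Polynomial.natDegree_map_le (f := Ideal.Quotient.mk I) (p := p)).trans hn) (le_refl Q.natDegree)
  rw [h, Polynomial.coeff_zero, Polynomial.coeff_map] at h1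
  obtain ⟨a, ha⟩ := Ideal.Quotient.mk_surjective (Q.coeff Q.natDegree)
  rw [← ha, ← map_mul, eq_comm, Ideal.Quotient.eq_zero_iff_mem] at h1
  have h2 := Ideal.Quotient.eq_zero_iff_mem.mpr (hp a h1)
  rw [ha] at h2
  exact hq (Polynomial.leadingCoeff_eq_zero.mp h2)

theorem IsRegFam.map_C {I : Ideal A} {s : Fin r → A} (hs : IsRegFam I s) :
    IsRegFam (I.map (Polynomial.C : A →+* Polynomial A)) fun i => Polynomial.C (s i) := by
  intro i f hf
  rw [spanLT_map] at hf ⊢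
  refine mem_map_C_of_mul_mem (p := Polynomial.C (s i)) (n := 0) (by simp) (fun a ha => ?_) hf
  rw [Polynomial.coeff_C_zero] at ha
  exact hs i a ha

/-- Adjoining variables `w` and `ξ`, the regular families `s` and `(h, s)` yield the regular family
`(h - u w^d, s, x + w ξ)`. -/
theorem IsRegFam.adjoin_variables {h u x : A} {s : Fin r → A} {d : ℕ} (hd : 0 < d) (hu : IsUnit u)
    (hs : IsRegFam ⊥ s) (hh : ∀ t f, h * f ∈ spanLT ⊥ s t → f ∈ spanLT ⊥ s t) :
    IsRegFam ⊥ (Fin.cons (Polynomial.C (Polynomial.C h - Polynomial.C u * Polynomial.X ^ d))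
      (Fin.snoc (fun i => Polynomial.C (Polynomial.C (s i)))
        (Polynomial.C (Polynomial.C x) + Polynomial.C Polynomial.X * Polynomial.X)) :
          Fin (r + 2) → Polynomial (Polynomial A)) := by
  have hCbot : (⊥ : Ideal A).map (Polynomial.C : A →+* Polynomial A) = ⊥ := Ideal.map_bot
  set H : Polynomial A := Polynomial.C h - Polynomial.C u * Polynomial.X ^ d with hH
  have hHdeg : H.natDegree ≤ d := by
    rw [hH]
    refine (Polynomial.natDegree_sub_le _ _).trans (max_le (by simp) ?_)
    exact Polynomial.natDegree_C_mul_X_pow_le _ _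
  have hHcoeff : H.coeff d = -u := by
    rw [hH, Polynomial.coeff_sub, Polynomial.coeff_C_mul_X_pow, Polynomial.coeff_C, if_neg hd.ne',
      if_pos rfl, zero_sub]
  -- As `d > 0`, the coefficient of `H` in degree `d` is the unit `-u`, so `H` is a nonzerodivisor
  -- modulo every ideal extended from `A`.
  have hHreg : ∀ (I : Ideal A) (f : Polynomial A), H * f ∈ I.map (Polynomial.C : A →+* Polynomial A) →
      f ∈ I.map (Polynomial.C : A →+* Polynomial A) := fun I f hf => by
    refine mem_map_C_of_mul_mem hHdeg (fun a ha => ?_) hf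
    rw [hHcoeff, neg_mul, neg_mem_iff] at ha
    exact (Ideal.unit_mul_mem_iff_mem I hu).mp ha
  have hsB : IsRegFam ⊥ fun i => (Polynomial.C (s i) : Polynomial A) := by
    have := hs.map_C
    rwa [hCbot] at this
  have hspan : ∀ t, spanLT ⊥ (fun i => (Polynomial.C (s i) : Polynomial A)) t =
      (spanLT ⊥ s t).map (Polynomial.C : A →+* Polynomial A) := fun t => by
    rw [← spanLT_map, hCbot]
  have hsH : IsRegFam (⊥ ⊔ Ideal.span {H}) fun i => (Polynomial.C (s i) : Polynomial A) :=
    hsB.sup_span_singleton fun t f hf => by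
      rw [hspan] at hf ⊢
      exact hHreg _ f hf
  -- Let `J` be the ideal of `s`. If `w f ≡ g H` modulo `J`, the constant term gives `g_0 h ∈ J`,
  -- hence `g_0 ∈ J` by `hh`. So `g ≡ w g'`, and `w` cancels from `w (f - g' H)`.
  have hX : ∀ f, Polynomial.X * f ∈
      spanLT (⊥ ⊔ Ideal.span {H}) (fun i => (Polynomial.C (s i) : Polynomial A)) r →
      f ∈ spanLT (⊥ ⊔ Ideal.span {H}) (fun i => (Polynomial.C (s i) : Polynomial A)) r := by
    intro f hf
    rw [spanLT_sup, mem_sup_span_singleton_iff, hspan] at hf ⊢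
    obtain ⟨g, hg⟩ := hf
    have hg0 : g.coeff 0 ∈ spanLT ⊥ s r := by
      have h1 := Ideal.mem_map_C_iff.mp hg 0
      rw [Polynomial.coeff_sub, Polynomial.mul_coeff_zero, Polynomial.mul_coeff_zero,
        Polynomial.coeff_X_zero, zero_mul, zero_sub, neg_mem_iff, hH, Polynomial.coeff_sub,
        Polynomial.coeff_C_zero, Polynomial.coeff_C_mul_X_pow, if_neg hd.ne, sub_zero, mul_comm] at h1
      exact hh r _ h1
    have hdec : g = Polynomial.X * g.divX + Polynomial.C (g.coeff 0) := (Polynomial.X_mul_divX_add g).symm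
    refine ⟨g.divX, mem_map_C_of_mul_mem (p := Polynomial.X) (n := 1) Polynomial.natDegree_X_le
      (fun a ha => by simpa using ha) ?_⟩
    have h2 := Ideal.mul_mem_right H _ (Ideal.mem_map_of_mem (Polynomial.C : A →+* Polynomial A) hg0)
    convert add_mem hg h2 using 1
    linear_combination H * hdec
  rw [isRegFam_cons_iff]
  constructor
  · intro f hf
    have h1 : ((⊥ : Ideal (Polynomial A)).map
        (Polynomial.C : Polynomial A →+* Polynomial (Polynomial A))) = ⊥ := Ideal.map_bot
    rw [← h1] at hf ⊢
    refine mem_map_C_of_mul_mem (n := 0) (by simp) (fun a ha => ?_) hf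
    rw [Polynomial.coeff_C_zero] at ha
    have := hHreg ⊥ a
    rw [hCbot] at this
    exact this ha
  · have hI : (⊥ ⊔ Ideal.span {Polynomial.C H} : Ideal (Polynomial (Polynomial A))) =
        (⊥ ⊔ Ideal.span {H}).map (Polynomial.C : Polynomial A →+* Polynomial (Polynomial A)) := by
      rw [bot_sup_eq, bot_sup_eq, Ideal.map_span, Set.image_singleton]
    rw [hI]
    -- The last member has degree one in the outer variable `ξ`, with leading coefficient `w`, so
    -- `hX` suffices.
    refine hsH.map_C.snoc fun f hf => ?_
    rw [spanLT_map] at hf ⊢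
    refine mem_map_C_of_mul_mem (n := 1) ?_ (fun a ha => hX a ?_) hf
    · refine (Polynomial.natDegree_add_le _ _).trans (max_le (by simp) ?_)
      simpa using Polynomial.natDegree_C_mul_X_pow_le (Polynomial.X : Polynomial A) 1
    · simpa [Polynomial.coeff_C] using ha

end Polynomials

/-! ### Krull dimension of the quotient by a regular family -/

section Dimension

/-- Over a Jacobson ring a maximal ideal of `R[X]` contracts to a maximal ideal, and the height goes
up by one. -/
theorem height_polynomial_of_isMaximal {R : Type*} [CommRing R] [IsNoetherianRing R] [IsJacobsonRing R]
    {e : ℕ∞} (h : ∀ M : Ideal R, M.IsMaximal → M.height = e) (M : Ideal (Polynomial R))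
    (hM : M.IsMaximal) : M.height = e + 1 := by
  have h1 : (M.comap (Polynomial.C : R →+* Polynomial R)).IsMaximal :=
    Polynomial.isMaximal_comap_C_of_isJacobsonRing M
  have h2 : M.LiesOver (M.comap (Polynomial.C : R →+* Polynomial R)) := ⟨rfl⟩
  rw [Polynomial.height_eq_height_add_one (M.comap (Polynomial.C : R →+* Polynomial R)) M, h _ h1]

theorem height_mvPolynomial_of_isMaximal {R : Type*} [CommRing R] [IsNoetherianRing R] [IsJacobsonRing R]
    {e : ℕ∞} (h : ∀ M : Ideal R, M.IsMaximal → M.height = e) (n : ℕ)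
    (M : Ideal (MvPolynomial (Fin n) R)) (hM : M.IsMaximal) : M.height = e + n := by
  induction n with
  | zero =>
    have := Ideal.map_isMaximal_of_equiv (isEmptyAlgEquiv R (Fin 0)).toRingEquiv (p := M)
    rw [← (isEmptyAlgEquiv R (Fin 0)).toRingEquiv.height_map M, h _ this, Nat.cast_zero, add_zero]
  | succ n ih =>
    have := Ideal.map_isMaximal_of_equiv (finSuccEquiv R n).toRingEquiv (p := M)
    rw [← (finSuccEquiv R n).toRingEquiv.height_map M, height_polynomial_of_isMaximal ih _ this,
      Nat.cast_succ, add_assoc]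

theorem height_of_isMaximal_gr {N : ℕ} (M : Ideal (Gr N)) (hM : M.IsMaximal) :
    M.height = (N : ℕ∞) + N := by
  refine height_mvPolynomial_of_isMaximal (fun K hK => ?_) N M hM
  have h0 : ∀ K : Ideal ℂ, K.IsMaximal → K.height = 0 := fun K hK => by
    have hK' : K = ⊥ := (Ideal.eq_bot_or_top K).resolve_right hK.ne_top
    rw [hK', Ideal.height_bot]
  rw [height_mvPolynomial_of_isMaximal h0 N K hK, zero_add]

theorem ringKrullDim_quotient_spanLT_add_le {R : Type*} [CommRing R] {r : ℕ} {I : Ideal R}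
    {s : Fin r → R} (hs : IsRegFam I s) {t : ℕ} (ht : t ≤ r) :
    ringKrullDim (R ⧸ spanLT I s t) + t ≤ ringKrullDim (R ⧸ I) := by
  induction t with
  | zero => rw [spanLT_zero, Nat.cast_zero, add_zero]
  | succ t ih =>
    refine le_trans ?_ (ih (Nat.le_of_succ_le ht))
    obtain ⟨τ, rfl⟩ : ∃ τ : Fin r, (τ : ℕ) = t := ⟨⟨t, ht⟩, rfl⟩
    have hnzd : Ideal.Quotient.mk (spanLT I s τ) (s τ) ∈ nonZeroDivisors (R ⧸ spanLT I s τ) := by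
      rw [mem_nonZeroDivisors_iff_right]
      intro x hx
      obtain ⟨f, rfl⟩ := Ideal.Quotient.mk_surjective x
      rw [← map_mul, Ideal.Quotient.eq_zero_iff_mem, mul_comm] at hx
      exact Ideal.Quotient.eq_zero_iff_mem.mpr (hs τ f hx)
    have h1 := ringKrullDim_quotient_succ_le_of_nonZeroDivisor hnzd
    have e := DoubleQuot.quotQuotEquivQuotSup (spanLT I s τ) (Ideal.span {s τ})
    rw [Ideal.map_span, Set.image_singleton, ← spanLT_succ] at e
    rw [ringKrullDim_eq_of_ringEquiv e] at h1
    calc ringKrullDim (R ⧸ spanLT I s (τ + 1)) + ((τ + 1 : ℕ) : WithBot ℕ∞)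
        = ringKrullDim (R ⧸ spanLT I s (τ + 1)) + 1 + (τ : ℕ) := by
          push_cast
          rw [add_assoc, add_comm (1 : WithBot ℕ∞)]
      _ ≤ _ := by gcongr

/-- Upper bound: each of the `N` nonzerodivisors lowers the dimension `2N` by at least one. Lower
bound: a maximal ideal containing the family exists and has height `2N`, and `N` elements lower it
by at most `N`. -/
theorem ringKrullDim_gr_quotient {N : ℕ} {s : Fin N → Gr N} (hs : IsRegFam ⊥ s)
    (htop : Ideal.span (Set.range s) ≠ ⊤) :
    ringKrullDim (Gr N ⧸ Ideal.span (Set.range s)) = (N : WithBot ℕ∞) := by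
  have hcancel : ∀ a : WithBot ℕ∞, a + (N : WithBot ℕ∞) ≤ (N : WithBot ℕ∞) + N → a ≤ N := by
    intro a ha
    induction a using WithBot.recBotCoe with
    | bot => exact bot_le
    | coe a =>
      have h1 : ((a + (N : ℕ∞) : ℕ∞) : WithBot ℕ∞) ≤ (((N : ℕ∞) + (N : ℕ∞) : ℕ∞) : WithBot ℕ∞) := ha
      have h2 := WithBot.coe_le_coe.mp h1
      have h3 : a ≤ N := (ENat.add_le_add_iff_right (ENat.natCast_ne_top N)).mp h2
      exact WithBot.coe_le_coe.mpr h3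
  have hcancel' : ∀ a : WithBot ℕ∞, (N : WithBot ℕ∞) + N ≤ a + (N : WithBot ℕ∞) → N ≤ a := by
    intro a ha
    induction a using WithBot.recBotCoe with
    | bot =>
      rw [WithBot.bot_add, le_bot_iff] at ha
      exact absurd ha (WithBot.coe_ne_bot (a := ((N : ℕ∞) + (N : ℕ∞) : ℕ∞)))
    | coe a =>
      have h1 : (((N : ℕ∞) + (N : ℕ∞) : ℕ∞) : WithBot ℕ∞) ≤ ((a + (N : ℕ∞) : ℕ∞) : WithBot ℕ∞) := ha
      have h2 := WithBot.coe_le_coe.mp h1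
      have h3 : (N : ℕ∞) ≤ a := (ENat.add_le_add_iff_right (ENat.natCast_ne_top N)).mp h2
      exact WithBot.coe_le_coe.mpr h3
  apply le_antisymm
  · apply hcancel
    have h1 := ringKrullDim_quotient_spanLT_add_le hs le_rfl
    rw [spanLT_of_le _ _ le_rfl, bot_sup_eq] at h1
    refine h1.trans ((ringKrullDim_quotient_le _).trans ?_)
    rw [MvPolynomial.ringKrullDim_of_isNoetherianRing, MvPolynomial.ringKrullDim_of_isNoetherianRing,
      ringKrullDim_eq_zero_of_field, zero_add, Nat.card_eq_fintype_card, Fintype.card_fin]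
  · apply hcancel'
    obtain ⟨M, hM, hle⟩ := Ideal.exists_le_maximal _ htop
    have h1 := Ideal.height_le_ringKrullDim_quotient_add_encard (p := M) (Set.range s)
      (fun x hx => hle (Ideal.subset_span hx))
    rw [height_of_isMaximal_gr M hM] at h1
    have h2 : (Set.range s).encard ≤ (N : ℕ∞) := by
      rw [← Set.image_univ]
      refine (Set.encard_image_le _ _).trans ?_
      simp
    have h3 : ((Set.range s).encard : WithBot ℕ∞) ≤ (N : WithBot ℕ∞) := WithBot.coe_le_coe.mpr h2
    refine le_trans ?_ (h1.trans (by gcongr))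
    exact le_of_eq rfl

end Dimension

/-! ### Symbols of vector fields -/

/-- The linear form `∑ θ(x_i) ξ_i` of a vector field `θ`. -/
noncomputable def derSymbol (N : ℕ) : Derivation ℂ (PolyRing N) (PolyRing N) →ₗ[PolyRing N] Gr N where
  toFun θ := ∑ i, θ (X i) • (X i : Gr N)
  map_add' θ η := by simp only [Derivation.add_apply, add_smul, Finset.sum_add_distrib]
  map_smul' f θ := by
    simp only [Derivation.smul_apply, smul_eq_mul, mul_smul, Finset.smul_sum, RingHom.id_apply]

theorem derSymbol_apply {N : ℕ} (θ : Derivation ℂ (PolyRing N) (PolyRing N)) :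
    derSymbol N θ = ∑ i, θ (X i) • (X i : Gr N) := rfl

theorem derivation_sum_apply {N : ℕ} {ι : Type*} (s : Finset ι)
    (F : ι → Derivation ℂ (PolyRing N) (PolyRing N)) (f : PolyRing N) :
    (∑ i ∈ s, F i) f = ∑ i ∈ s, F i f := by
  classical
  induction s using Finset.induction_on with
  | empty => simp
  | insert a s ha ih => rw [Finset.sum_insert ha, Finset.sum_insert ha, Derivation.add_apply, ih]

theorem derivation_eq_sum {N : ℕ} (θ : Derivation ℂ (PolyRing N) (PolyRing N)) :
    θ = ∑ i, θ (X i) • pderiv (R := ℂ) i := by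
  refine MvPolynomial.derivation_ext fun j => ?_
  rw [derivation_sum_apply, Finset.sum_eq_single j]
  · simp
  · intro b _ hb
    simp [pderiv_X, hb.symm]
  · simp

theorem derSymbol_pderiv {N : ℕ} (i : Fin N) : derSymbol N (pderiv i) = X i := by
  rw [derSymbol_apply, Finset.sum_eq_single i]
  · simp
  · intro b _ hb
    simp [pderiv_X, hb]
  · simp

theorem derSymbol_isHomogeneous {N : ℕ} (θ : Derivation ℂ (PolyRing N) (PolyRing N)) :
    (derSymbol N θ).IsHomogeneous 1 := by
  rw [derSymbol_apply]
  refine IsHomogeneous.sum _ _ _ fun i _ => ?_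
  rw [smul_eq_C_mul]
  exact isHomogeneous_C_mul_X _ _

theorem coeff_derSymbol {N : ℕ} (θ : Derivation ℂ (PolyRing N) (PolyRing N)) (i : Fin N) :
    coeff (Finsupp.single i 1) (derSymbol N θ) = θ (X i) := by
  classical
  rw [derSymbol_apply, coeff_sum, Finset.sum_eq_single i]
  · simp
  · intro b _ hb
    rw [coeff_smul, coeff_X, if_neg, smul_zero]
    exact fun h => hb (Finsupp.single_left_injective one_ne_zero h)
  · simp

theorem totalSymbol_ofPoly {N : ℕ} (f : PolyRing N) : totalSymbol N (ofPoly f) = C f := by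
  rw [totalSymbol_eq_iff, normalOrder_C]
  rfl

theorem totalSymbol_ofDer {N : ℕ} (θ : Derivation ℂ (PolyRing N) (PolyRing N)) :
    totalSymbol N (ofDer θ) = derSymbol N θ := by
  rw [totalSymbol_eq_iff, derSymbol_apply, map_sum]
  apply LinearMap.ext
  intro u
  change θ u = _
  conv_lhs => rw [derivation_eq_sum θ]
  rw [derivation_sum_apply, LinearMap.sum_apply]
  refine Finset.sum_congr rfl fun i _ => ?_
  rw [smul_eq_C_mul, normalOrder_C_mul, ← one_mul (X i : Gr N), normalOrder_mul_X, ← C_1, normalOrder_C]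
  simp [mulOp, partialOp]

theorem symbol_ofPoly {N : ℕ} (f : PolyRing N) : symbol (ofPoly f) = C f := by
  refine symbol_eq_of_sub_mem (isHomogeneous_C _ _) ?_ fun h => ?_
  · rw [totalSymbol_ofPoly, sub_self]
    exact zero_mem _
  · rw [← (totalSymbol N).map_eq_zero_iff, totalSymbol_ofPoly, h]

theorem symbol_ofDer {N : ℕ} (θ : Derivation ℂ (PolyRing N) (PolyRing N)) :
    symbol (ofDer θ) = derSymbol N θ := by
  refine symbol_eq_of_sub_mem (derSymbol_isHomogeneous _) ?_ fun h => ?_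
  · rw [totalSymbol_ofDer, sub_self]
    exact zero_mem _
  · rw [← (totalSymbol N).map_eq_zero_iff, totalSymbol_ofDer, h]

/-! ### Regularity of the symbols of logarithmic vector fields -/

section LogRegular

variable {N : ℕ} {s : Fin N → Gr N}

theorem degComp_mem_spanLT {r : ℕ} {s : Fin r → Gr N} {k : Fin r → ℕ} (hs : ∀ i, (s i).IsHomogeneous (k i))
    {t : ℕ} {x : Gr N} (hx : x ∈ spanLT ⊥ s t) (e : ℤ) : degComp N e x ∈ spanLT ⊥ s t := by
  rw [spanLT_bot] at hx ⊢
  obtain ⟨b, hb, rfl⟩ := mem_span_image_iff.mp hx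
  rw [map_sum]
  refine Ideal.sum_mem _ fun j _ => ?_
  rw [degComp_mul _ _ (hs j)]
  by_cases hj : j ∈ {j : Fin r | (j : ℕ) < t}
  · exact Ideal.mul_mem_left _ _ (Ideal.subset_span ⟨j, hj, rfl⟩)
  · rw [hb j hj, map_zero, zero_mul]
    exact zero_mem _

/-- Membership in an ideal of variables is tested on the support. Multiplying by `h ξ_i` only shifts
the support in a direction outside `S`, as the coefficients lie in a domain. -/
theorem mem_span_X_of_mul_mem {S : Set (Fin N)} {h : PolyRing N} (hh : h ≠ 0) {i : Fin N} (hi : i ∉ S)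
    {g : Gr N} (hg : C h * X i * g ∈ Ideal.span ((X : Fin N → Gr N) '' S)) :
    g ∈ Ideal.span ((X : Fin N → Gr N) '' S) := by
  rw [mem_ideal_span_X_image] at hg ⊢
  intro α hα
  have h1 : α + Finsupp.single i 1 ∈ (C h * X i * g).support := by
    rw [mem_support_iff, mul_assoc, coeff_C_mul, mul_comm (X i), coeff_mul_X]
    exact mul_ne_zero hh (mem_support_iff.mp hα)
  obtain ⟨j, hj, hne⟩ := hg _ h1
  refine ⟨j, hj, ?_⟩
  have hji : i ≠ j := by
    rintro rfl
    exact hi hj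
  rwa [Finsupp.add_apply, Finsupp.single_eq_of_ne hji.symm, add_zero] at hne

theorem aeval_C_mul_X {h : PolyRing N} {e : ℕ} {f : Gr N} (hf : f.IsHomogeneous e) :
    aeval (fun i => C h * X i : Fin N → Gr N) f = C (h ^ e) * f := by
  conv_lhs => rw [f.as_sum]
  conv_rhs => rw [f.as_sum]
  rw [map_sum, Finset.mul_sum]
  refine Finset.sum_congr rfl fun α hα => ?_
  have hdeg : α.degree = e := by
    by_contra hne
    exact (mem_support_iff.mp hα) (hf.coeff_eq_zero hne)
  rw [aeval_monomial, algebraMap_eq, Finsupp.prod]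
  simp only [mul_pow, Finset.prod_mul_distrib]
  rw [Finset.prod_pow_eq_pow_sum, ← C_pow]
  have h1 : ∑ i ∈ α.support, α i = e := hdeg
  rw [h1, monomial_eq, Finsupp.prod]
  ring

/-- With the next lemma this shows that the coefficient matrix of a logarithmic basis and the matrix
expressing the `h ∂_l` in that basis are inverse up to the factor `h`. -/
theorem sum_sum_mul_smul {R M ι : Type*} [Fintype ι] [CommRing R] [AddCommGroup M] [Module R M] {θ η : ι → M}
    {A : ι → ι → R} {h : R} (hA : ∀ l, ∑ i, A l i • θ i = h • η l) (b : ι → R) :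
    ∑ i, (∑ l, b l * A l i) • θ i = h • ∑ l, b l • η l := by
  simp only [Finset.smul_sum, smul_comm h, ← hA, Finset.sum_smul, mul_smul]
  exact Finset.sum_comm

theorem eq_ite_of_sum_smul_eq {R M ι : Type*} [Fintype ι] [DecidableEq ι] [CommRing R] [AddCommGroup M]
    [Module R M] {θ : ι → M} (hθ : LinearIndependent R θ) {a : ι → R} {h : R} {j : ι}
    (ha : ∑ i, a i • θ i = h • θ j) (i : ι) : a i = if i = j then h else 0 := by
  have h3 : ∑ i, (a i - if i = j then h else 0) • θ i = 0 := by
    simp only [sub_smul, Finset.sum_sub_distrib, ha, ite_smul, zero_smul, Finset.sum_ite_eq',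
      Finset.mem_univ, if_true, sub_self]
  exact sub_eq_zero.mp (Fintype.linearIndependent_iff.mp hθ _ h3 i)

/-- The substitutions `ψ` and `φ` are inverse up to powers of `h`: `ψ` sends `σ(θ_j)` to `h ξ_j`,
and `φ ∘ ψ` multiplies forms of degree `e` by `h ^ e`. So the relation is carried to the variables,
where `ξ_τ` and `h` cancel, and brought back by `φ`; `hreg` then removes `h ^ e`. -/
theorem mem_spanLT_of_derSymbol_mul_mem {θ : Fin N → Derivation ℂ (PolyRing N) (PolyRing N)}
    (hθ : LinearIndependent (PolyRing N) θ) {h : PolyRing N} (hh : h ≠ 0)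
    (hspan : ∀ i, h • pderiv (R := ℂ) i ∈ Submodule.span (PolyRing N) (Set.range θ)) (τ : Fin N)
    (hreg : ∀ f, C h * f ∈ spanLT ⊥ (fun i => derSymbol N (θ i)) τ →
      f ∈ spanLT ⊥ (fun i => derSymbol N (θ i)) τ) (f : Gr N)
    (hf : derSymbol N (θ τ) * f ∈ spanLT ⊥ (fun i => derSymbol N (θ i)) τ) :
    f ∈ spanLT ⊥ (fun i => derSymbol N (θ i)) τ := by
  simp only [Submodule.mem_span_range_iff_exists_fun] at hspan
  choose A hA using hspan
  set s : Fin N → Gr N := fun i => derSymbol N (θ i) with hs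
  have hhom : ∀ i, (s i).IsHomogeneous 1 := fun i => derSymbol_isHomogeneous _
  let ψ : Gr N →ₐ[PolyRing N] Gr N := aeval fun i => ∑ j, A i j • X j
  let φ : Gr N →ₐ[PolyRing N] Gr N := aeval s
  have hψs : ∀ j, ψ (s j) = C h * X j := by
    intro j
    have h1 : ∑ i, (∑ l, θ j (X l) * A l i) • θ i = h • θ j := by
      have h4 := sum_sum_mul_smul hA fun l => θ j (X l)
      rwa [← derivation_eq_sum] at h4
    have h2 := eq_ite_of_sum_smul_eq hθ h1
    calc ψ (s j) = ∑ l, θ j (X l) • ∑ i, A l i • (X i : Gr N) := by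
          simp only [hs, derSymbol_apply, map_sum, map_smul, ψ, aeval_X]
      _ = ∑ i, (∑ l, θ j (X l) * A l i) • (X i : Gr N) := by
          simp only [Finset.smul_sum, Finset.sum_smul, mul_smul]
          exact Finset.sum_comm
      _ = C h * X j := by
          simp only [h2, ite_smul, zero_smul, Finset.sum_ite_eq', Finset.mem_univ, if_true, smul_eq_C_mul]
  have hφψ : ∀ f, φ (ψ f) = aeval (fun i => C h * X i : Fin N → Gr N) f := by
    intro f
    have : φ.comp ψ = aeval (fun i => C h * X i : Fin N → Gr N) := by
      refine MvPolynomial.algHom_ext fun i => ?_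
      simp only [AlgHom.comp_apply, ψ, φ, aeval_X, map_sum, map_smul, hs]
      rw [← derSymbol_pderiv, ← smul_eq_C_mul, ← map_smul, ← hA, map_sum]
      simp only [map_smul]
    exact DFunLike.congr_fun this f
  have hhomog : ∀ (e : ℕ) (f : Gr N), f.IsHomogeneous e → s τ * f ∈ spanLT ⊥ s τ → f ∈ spanLT ⊥ s τ := by
    intro e f hfe hf
    rw [spanLT_bot] at hf ⊢
    have h1 : C h * X τ * ψ f ∈ Ideal.span ((X : Fin N → Gr N) '' {j | (j : ℕ) < τ}) := by
      rw [← hψs, ← map_mul]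
      have h2 := Ideal.mem_map_of_mem (ψ : Gr N →+* Gr N) hf
      rw [Ideal.map_span, Set.image_image] at h2
      refine (Ideal.span_le.mpr ?_) h2
      rintro _ ⟨j, hj, rfl⟩
      change ψ (s j) ∈ _
      rw [hψs]
      exact Ideal.mul_mem_left _ _ (Ideal.subset_span ⟨j, hj, rfl⟩)
    have h2 := mem_span_X_of_mul_mem hh (by simp) h1
    have h3 := Ideal.mem_map_of_mem (φ : Gr N →+* Gr N) h2
    rw [Ideal.map_span, Set.image_image] at h3
    change φ (ψ f) ∈ Ideal.span ((fun j => φ (X j)) '' _) at h3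
    rw [hφψ, aeval_C_mul_X hfe] at h3
    simp only [φ, aeval_X] at h3
    rw [← spanLT_bot] at h3 ⊢
    clear h1 h2 hf hfe
    induction e with
    | zero => simpa using h3
    | succ e ih =>
      refine ih (hreg _ ?_)
      rwa [← mul_assoc, ← C_mul, ← pow_succ']
  rw [← sum_homogeneousComponent f]
  refine Ideal.sum_mem _ fun e _ => hhomog e _ (homogeneousComponent_isHomogeneous e f) ?_
  -- The ideal is homogeneous and `s τ` has degree one, so the component of degree `e + 1` of the
  -- product is `s τ` times that of degree `e` of `f`.
  have h1 := degComp_mem_spanLT hhom hf ((e + 1 : ℕ) : ℤ)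
  rw [mul_comm, degComp_mul _ _ (hhom τ)] at h1
  have h2 : (((e + 1 : ℕ) : ℤ) - (1 : ℕ)) = (e : ℕ) := by push_cast; ring
  rw [h2, degComp_natCast] at h1
  rwa [mul_comm]

end LogRegular

/-! ### Adjoining a variable -/

section Extension

variable {n : ℕ}

/-- The inclusion of graded rings when the variable `w_0` is added. -/
noncomputable def extGr (n : ℕ) : Gr n →+* Gr (n + 1) :=
  eval₂Hom ((C : PolyRing (n + 1) →+* Gr (n + 1)).comp (rename Fin.succ : PolyRing n →ₐ[ℂ] PolyRing (n + 1)).toRingHom)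
    fun i => X i.succ

theorem extGr_C (f : PolyRing n) : extGr n (C f) = C (extPoly f) := by
  rw [extGr, coe_eval₂Hom, eval₂_C]
  rfl

theorem extGr_X (i : Fin n) : extGr n (X i) = X i.succ := by
  rw [extGr, coe_eval₂Hom, eval₂_X]

/-- Adding the variables `w_0`, `ξ_0` is adjoining two polynomial variables. -/
noncomputable def extGrHom (n : ℕ) : Polynomial (Polynomial (Gr n)) →+* Gr (n + 1) :=
  Polynomial.eval₂RingHom (Polynomial.eval₂RingHom (extGr n) (C (X 0))) (X 0)

/-- The inverse of `extGrHom`. -/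
noncomputable def extGrInv (n : ℕ) : Gr (n + 1) →+* Polynomial (Polynomial (Gr n)) :=
  eval₂Hom
    (eval₂Hom (Polynomial.C.comp (Polynomial.C.comp (C.comp C)))
      (Fin.cons (Polynomial.C Polynomial.X) fun i => Polynomial.C (Polynomial.C (C (X i)))))
    (Fin.cons Polynomial.X fun i => Polynomial.C (Polynomial.C (X i)))

theorem extGrInv_comp : (extGrInv n).comp (extGrHom n) = RingHom.id _ := by
  ext : 1
  · ext : 1
    · refine MvPolynomial.ringHom_ext (fun f => ?_) fun i => ?_
      · induction f using MvPolynomial.induction_on with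
        | C a => simp [extGrHom, extGrInv, extGr]
        | add p q hp hq => rw [map_add, map_add, map_add, hp, hq]
        | mul_X p i hp =>
          rw [map_mul, map_mul, map_mul, hp]
          simp [extGrHom, extGrInv, extGr]
      · simp [extGrHom, extGrInv, extGr]
    · simp [extGrHom, extGrInv]
  · simp [extGrHom, extGrInv]

theorem extGrHom_comp : (extGrHom n).comp (extGrInv n) = RingHom.id _ := by
  refine MvPolynomial.ringHom_ext (fun f => ?_) fun i => ?_
  · induction f using MvPolynomial.induction_on with
    | C a => simp [extGrHom, extGrInv, extGr]
    | add p q hp hq => rw [map_add, map_add, map_add, hp, hq]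
    | mul_X p i hp =>
      rw [map_mul, map_mul, map_mul, hp]
      refine Fin.cases ?_ (fun i => ?_) i <;> simp [extGrHom, extGrInv, extGr]
  · refine Fin.cases ?_ (fun i => ?_) i <;> simp [extGrHom, extGrInv, extGr]

/-- Adding the variables `w_0`, `ξ_0` is adjoining two polynomial variables, as an isomorphism. -/
noncomputable def extGrEquiv (n : ℕ) : Polynomial (Polynomial (Gr n)) ≃+* Gr (n + 1) :=
  RingEquiv.ofRingHom (extGrHom n) (extGrInv n) extGrHom_comp extGrInv_comp

theorem extGrEquiv_C_C (p : Gr n) : extGrEquiv n (Polynomial.C (Polynomial.C p)) = extGr n p := by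
  simp [extGrEquiv, extGrHom]

theorem extGrEquiv_C_X : extGrEquiv n (Polynomial.C Polynomial.X) = C (X 0) := by
  simp [extGrEquiv, extGrHom]

theorem extGrEquiv_X : extGrEquiv n Polynomial.X = X 0 := by
  simp [extGrEquiv, extGrHom]

theorem extDer_X_zero (θ : Derivation ℂ (PolyRing n) (PolyRing n)) : extDer θ (X 0) = 0 := by
  simp [extDer]

theorem extDer_X_succ (θ : Derivation ℂ (PolyRing n) (PolyRing n)) (i : Fin n) :
    extDer θ (X i.succ) = extPoly (θ (X i)) := by
  simp [extDer]

theorem extDer_extPoly (θ : Derivation ℂ (PolyRing n) (PolyRing n)) (f : PolyRing n) :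
    extDer θ (extPoly f) = extPoly (θ f) := by
  induction f using MvPolynomial.induction_on with
  | C a => simp [extPoly]
  | add p q hp hq =>
    simp only [extPoly, map_add] at hp hq ⊢
    rw [hp, hq]
  | mul_X p i hp =>
    have h1 : extDer θ (X i.succ) = extPoly (θ (X i)) := extDer_X_succ θ i
    simp only [extPoly, map_mul, rename_X, Derivation.leibniz, map_add, smul_eq_mul] at hp h1 ⊢
    rw [hp, h1]

theorem derSymbol_extDer (θ : Derivation ℂ (PolyRing n) (PolyRing n)) :
    derSymbol (n + 1) (extDer θ) = extGr n (derSymbol n θ) := by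
  rw [derSymbol_apply, derSymbol_apply, Fin.sum_univ_succ, extDer_X_zero, zero_smul, zero_add, map_sum]
  refine Finset.sum_congr rfl fun i _ => ?_
  rw [extDer_X_succ, smul_eq_C_mul, smul_eq_C_mul, map_mul, extGr_C, extGr_X]

theorem derSymbol_eulerTilde (p : Fin n → ℚ) :
    derSymbol (n + 1) (eulerTilde p) = extGr n (derSymbol n (eulerField p)) + C (X 0) * X 0 := by
  rw [eulerTilde, map_add, map_smul, derSymbol_extDer, derSymbol_pderiv, smul_eq_C_mul]

theorem ringHom_C_sub_mul_X_pow {A B F : Type*} [CommRing A] [CommRing B]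
    [FunLike F (Polynomial (Polynomial A)) B] [RingHomClass F (Polynomial (Polynomial A)) B] (e : F)
    (a b : A) (d : ℕ) :
    e (Polynomial.C (Polynomial.C a - Polynomial.C b * Polynomial.X ^ d)) =
      e (Polynomial.C (Polynomial.C a)) - e (Polynomial.C (Polynomial.C b)) *
        e (Polynomial.C Polynomial.X) ^ d := by
  simp only [map_sub, map_mul, map_pow]

theorem extGrEquiv_hTilde (h : PolyRing n) (c : ℂ) (d : ℕ) :
    extGrEquiv n (Polynomial.C (Polynomial.C (C h) - Polynomial.C (C (C c)) * Polynomial.X ^ d)) =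
      C (hTilde h c d) := by
  refine (ringHom_C_sub_mul_X_pow (extGrEquiv n) _ _ d).trans ?_
  rw [extGrEquiv_C_C, extGrEquiv_C_C, extGrEquiv_C_X, extGr_C, extGr_C, hTilde, map_sub, map_mul, map_pow]
  simp [extPoly]

end Extension

/-! ### Holonomicity of cyclic modules -/

section Cyclic

variable {N : ℕ}

/-- The operator `∂^α` as an element of the ring of differential operators. -/
noncomputable def dPow (α : Fin N →₀ ℕ) : D N := (totalSymbol N).symm (monomial α 1)

theorem dPow_mem (α : Fin N →₀ ℕ) : dPow α ∈ ordLE N α.degree :=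
  symm_mem_ordLE.mpr (monomial_mem_degLE le_rfl 1)

theorem ofPoly_mem (f : PolyRing N) : (ofPoly f : D N) ∈ ordLE N 0 := by
  rw [mem_ordLE, totalSymbol_ofPoly]
  exact monomial_mem_degLE (by simp) f

theorem symm_monomial (α : Fin N →₀ ℕ) (f : PolyRing N) :
    (totalSymbol N).symm (monomial α f) = ofPoly f * dPow α := by
  apply toOp_injective
  rw [map_mul, dPow, toOp_totalSymbol_symm, toOp_totalSymbol_symm, normalOrder_monomial,
    normalOrder_monomial, ← mul_assoc]
  congr 1
  refine LinearMap.ext fun u => ?_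
  change f * u = f * (1 * u)
  rw [one_mul]

theorem partialPow_add (α β : Fin N →₀ ℕ) :
    (partialPow (α + β) : Module.End ℂ (PolyRing N)) = partialPow α * partialPow β := by
  induction β using Finsupp.induction_linear generalizing α with
  | zero => rw [add_zero, partialPow_zero, mul_one]
  | add β γ hβ hγ => rw [← add_assoc, hγ, hβ, hγ β, mul_assoc]
  | single j k =>
    induction k generalizing α with
    | zero => rw [Finsupp.single_zero, add_zero, partialPow_zero, mul_one]
    | succ k ih => rw [Finsupp.single_add, ← add_assoc, partialPow_succ, ih, partialPow_succ, mul_assoc]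

theorem dPow_add (α β : Fin N →₀ ℕ) : dPow (α + β) = dPow α * dPow β := by
  apply toOp_injective
  simp only [dPow, map_mul, toOp_totalSymbol_symm, normalOrder_monomial]
  have h1 : (mulOp 1 : Module.End ℂ (PolyRing N)) = 1 := LinearMap.ext fun u => by simp [mulOp]
  rw [h1, one_mul, one_mul, one_mul, partialPow_add]

theorem ordLE_induction {s : ℤ} {M : D N → Prop} (h0 : M 0) (hadd : ∀ P Q, M P → M Q → M (P + Q))
    (hmon : ∀ (α : Fin N →₀ ℕ) (f : PolyRing N), (α.degree : ℤ) ≤ s → M (ofPoly f * dPow α))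
    {P : D N} (hP : P ∈ ordLE N s) : M P := by
  rw [← (totalSymbol N).symm_apply_apply P]
  refine degLE_induction (M := fun p => M ((totalSymbol N).symm p)) (by rwa [map_zero])
    (fun p q hp hq => by rw [map_add]; exact hadd _ _ hp hq) (fun α f hα => ?_) (mem_ordLE.mp hP)
  rw [symm_monomial]
  exact hmon α f hα

theorem exists_add_of_degree_le {i j : ℕ} {α : Fin N →₀ ℕ} (hα : α.degree ≤ i + j) :
    ∃ β γ : Fin N →₀ ℕ, α = β + γ ∧ β.degree ≤ i ∧ γ.degree ≤ j := by
  induction i generalizing α with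
  | zero => exact ⟨0, α, (zero_add _).symm, by simp, by omega⟩
  | succ i ih =>
    by_cases h0 : α = 0
    · exact ⟨0, 0, by simp [h0], by simp, by simp⟩
    obtain ⟨l, hl⟩ := Finsupp.ne_iff.mp h0
    have hle : Finsupp.single l 1 ≤ α := by
      rw [Finsupp.single_le_iff]
      exact Nat.one_le_iff_ne_zero.mpr hl
    have hdec : α - Finsupp.single l 1 + Finsupp.single l 1 = α := tsub_add_cancel_of_le hle
    have hd := degree_add_single (α - Finsupp.single l 1) l
    rw [hdec] at hd
    obtain ⟨β, γ, h1, h2, h3⟩ := ih (α := α - Finsupp.single l 1) (by omega)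
    refine ⟨β + Finsupp.single l 1, γ, ?_, by rw [degree_add_single]; omega, h3⟩
    rw [← hdec, h1]
    abel

/-- The filtration on `D ⧸ I` induced by the order filtration. -/
noncomputable def orderQuotientFiltration (I : Submodule (D N) (D N)) (j : ℕ) : AddSubgroup (D N ⧸ I) :=
  (ordLE N j).toAddSubgroup.map I.mkQ.toAddMonoidHom

variable {I : Submodule (D N) (D N)}

theorem mem_orderQuotientFiltration {j : ℕ} {u : D N ⧸ I} :
    u ∈ orderQuotientFiltration I j ↔ ∃ P ∈ ordLE N j, Submodule.Quotient.mk P = u := Iff.rfl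

theorem smul_mem_orderQuotientFiltration {i j : ℕ} {P : D N} (hP : P ∈ orderFiltration N i) {u : D N ⧸ I}
    (hu : u ∈ orderQuotientFiltration I j) : P • u ∈ orderQuotientFiltration I (i + j) := by
  obtain ⟨A, hA, rfl⟩ := mem_orderQuotientFiltration.mp hu
  refine mem_orderQuotientFiltration.mpr ⟨P * A, ?_, rfl⟩
  rw [Nat.cast_add]
  exact mul_mem_ordLE (mem_orderFiltration.mp hP) hA

theorem mk_mem_of_ordLE {s : ℤ} {K : AddSubgroup (D N ⧸ I)}
    (hmon : ∀ (α : Fin N →₀ ℕ) (f : PolyRing N), (α.degree : ℤ) ≤ s →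
      (Submodule.Quotient.mk (ofPoly f * dPow α) : D N ⧸ I) ∈ K) {P : D N} (hP : P ∈ ordLE N s) :
    (Submodule.Quotient.mk P : D N ⧸ I) ∈ K :=
  ordLE_induction (M := fun P => (Submodule.Quotient.mk P : D N ⧸ I) ∈ K)
    (by rw [Submodule.Quotient.mk_zero]; exact zero_mem _)
    (fun P Q hP hQ => by rw [Submodule.Quotient.mk_add]; exact add_mem hP hQ) hmon hP

theorem isGoodFiltration_orderQuotientFiltration (I : Submodule (D N) (D N)) :
    IsGoodFiltration (N := N) (orderQuotientFiltration I) where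
  mono := fun i j hij => AddSubgroup.map_mono (ordLE_mono (by exact_mod_cast hij))
  exhaustive := fun u => by
    obtain ⟨P, rfl⟩ := Submodule.Quotient.mk_surjective I u
    exact ⟨order P, P, mem_degLE_totalDegree _, rfl⟩
  smul_mem := fun i j P hP u hu => smul_mem_orderQuotientFiltration hP hu
  finite := fun j => by
    classical
    have hfin : {α : Fin N →₀ ℕ | α.degree ≤ j}.Finite := Finsupp.finite_of_degree_le j
    refine ⟨hfin.toFinset.image fun α => Submodule.Quotient.mk (dPow α), le_antisymm ?_ ?_⟩
    · rintro _ ⟨P, hP, rfl⟩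
      refine mk_mem_of_ordLE (fun α f hα => ?_) hP
      refine AddSubgroup.subset_closure ⟨f, Submodule.Quotient.mk (dPow α), ?_, rfl⟩
      exact Finset.mem_image_of_mem _ (hfin.mem_toFinset.mpr (by exact_mod_cast hα))
    · rw [AddSubgroup.closure_le]
      rintro _ ⟨f, v, hv, rfl⟩
      obtain ⟨α, hα, rfl⟩ := Finset.mem_image.mp hv
      have hα' : α.degree ≤ j := hfin.mem_toFinset.mp hα
      refine mem_orderQuotientFiltration.mpr ⟨ofPoly f * dPow α, ?_, rfl⟩
      exact ordLE_mono (by omega) (mul_mem_ordLE (ofPoly_mem f) (dPow_mem α))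
  -- Splitting `∂^α` as `∂^β ∂^γ` shows that the filtration is generated from level `0` on.
  generated := ⟨0, fun j _ i => le_antisymm (by
      rintro _ ⟨P, hP, rfl⟩
      refine mk_mem_of_ordLE (fun α f hα => ?_) hP
      obtain ⟨β, γ, rfl, hβ, hγ⟩ := exists_add_of_degree_le (i := i) (j := j) (by exact_mod_cast hα)
      refine AddSubgroup.subset_closure ⟨ofPoly f * dPow β, ?_, Submodule.Quotient.mk (dPow γ), ?_, ?_⟩
      · rw [mem_orderFiltration]
        exact ordLE_mono (by omega) (mul_mem_ordLE (ofPoly_mem f) (dPow_mem β))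
      · exact mem_orderQuotientFiltration.mpr ⟨_, ordLE_mono (by omega) (dPow_mem γ), rfl⟩
      · rw [dPow_add, ← mul_assoc]
        rfl) (by
      rw [AddSubgroup.closure_le]
      rintro _ ⟨P, hP, v, hv, rfl⟩
      exact smul_mem_orderQuotientFiltration hP hv)⟩

theorem mem_prevStep_iff {j : ℕ} {u : D N ⧸ I} :
    u ∈ prevStep (orderQuotientFiltration I) j ↔ ∃ P ∈ ordLE N (j - 1), Submodule.Quotient.mk P = u := by
  cases j with
  | zero =>
    change u ∈ (⊥ : AddSubgroup _) ↔ _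
    rw [AddSubgroup.mem_bot]
    constructor
    · rintro rfl
      exact ⟨0, zero_mem _, rfl⟩
    · rintro ⟨P, hP, rfl⟩
      have h1 : totalSymbol N P = 0 := eq_zero_of_mem_degLE (by simp) (mem_ordLE.mp hP)
      rw [(totalSymbol N).map_eq_zero_iff.mp h1]
      rfl
  | succ j =>
    rw [Nat.cast_succ, add_sub_cancel_right]
    rfl

/-- A form that kills the graded module kills the class of `1`, so its lift differs from an element
of `I` by lower order. Conversely, for `Q ∈ I` the operator `Q A` is congruent to the commutator of
`Q` and `A` modulo `I`, which has lower order. -/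
theorem charIdeal_orderQuotientFiltration (I : Submodule (D N) (D N)) :
    charIdeal N (orderQuotientFiltration I) = symbolIdeal I := by
  apply le_antisymm
  · rw [charIdeal, Ideal.span_le]
    rintro p ⟨k, hp, hk⟩
    have h1 := hk 0 (Submodule.Quotient.mk 1) (mem_orderQuotientFiltration.mpr
      ⟨1, by
        rw [mem_ordLE, (totalSymbol_eq_iff (p := C 1)).mpr]
        · exact monomial_mem_degLE (by simp) 1
        · rw [map_one, normalOrder_C]
          exact LinearMap.ext fun u => by simp [mulOp], rfl⟩)
    obtain ⟨Q, hQ, hQ'⟩ := mem_prevStep_iff.mp h1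
    have h2 : (totalSymbol N).symm p - Q ∈ I := by
      rw [← Submodule.Quotient.eq, hQ', ← Submodule.Quotient.mk_smul, smul_eq_mul, mul_one]
    by_cases hp0 : p = 0
    · rw [hp0]
      exact zero_mem _
    have h3 : symbol ((totalSymbol N).symm p - Q) = p := by
      refine symbol_eq_of_sub_mem hp ?_ fun h => absurd h hp0
      rw [map_sub, LinearEquiv.apply_symm_apply, sub_sub_cancel_left]
      have := mem_ordLE.mp hQ
      rw [zero_add] at this
      exact neg_mem this
    rw [← h3]
    exact Ideal.subset_span ⟨_, h2, rfl⟩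
  · rw [symbolIdeal, Ideal.span_le]
    rintro _ ⟨Q, hQ, rfl⟩
    refine Ideal.subset_span ⟨order Q, homogeneousComponent_isHomogeneous _ _, fun j u hu => ?_⟩
    obtain ⟨A, hA, rfl⟩ := mem_orderQuotientFiltration.mp hu
    set P := (totalSymbol N).symm (symbol Q) with hP
    have hQk : Q ∈ ordLE N (order Q) := mem_degLE_totalDegree _
    have hPQ : P - Q ∈ ordLE N (order Q - 1) := by
      rw [mem_ordLE, map_sub, hP, LinearEquiv.apply_symm_apply, ← neg_mem_iff, neg_sub, symbol_eq_degComp]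
      exact sub_degComp_mem hQk
    refine mem_prevStep_iff.mpr ⟨(P - Q) * A + (Q * A - A * Q), ?_, ?_⟩
    · rw [Nat.cast_add]
      refine add_mem (ordLE_mono (by omega) (mul_mem_ordLE hPQ hA))
        (ordLE_mono (by omega) (commutator_mem_ordLE hQk hA))
    · rw [← Submodule.Quotient.mk_smul, Submodule.Quotient.eq, smul_eq_mul]
      have : (P - Q) * A + (Q * A - A * Q) - P * A = -(A * Q) := by
        rw [sub_mul]
        abel
      rw [this]
      exact neg_mem (I.smul_mem A hQ)

theorem isHolonomic_quotient (h : ringKrullDim (Gr N ⧸ symbolIdeal I) = (N : WithBot ℕ∞)) :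
    IsHolonomic N (D N ⧸ I) :=
  ⟨Module.Finite.quotient (D N) I, Or.inr ⟨orderQuotientFiltration I, isGoodFiltration_orderQuotientFiltration I,
    by rwa [charIdeal_orderQuotientFiltration]⟩⟩

end Cyclic

/-! ### Commutators of vector fields -/

section Commutators

variable {n : ℕ}

theorem ofDer_mul_sub (θ η : Derivation ℂ (PolyRing n) (PolyRing n)) :
    ofDer θ * ofDer η - ofDer η * ofDer θ = ofDer ⁅θ, η⁆ := by
  apply toOp_injective
  rw [map_sub, map_mul, map_mul]
  refine LinearMap.ext fun u => ?_
  change θ (η u) - η (θ u) = ⁅θ, η⁆ u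
  rw [Derivation.commutator_apply]

theorem ofDer_mul_ofPoly_sub (θ : Derivation ℂ (PolyRing n) (PolyRing n)) (f : PolyRing n) :
    ofDer θ * ofPoly f - ofPoly f * ofDer θ = ofPoly (θ f) := by
  apply toOp_injective
  rw [map_sub, map_mul, map_mul]
  refine LinearMap.ext fun u => ?_
  change θ (f * u) - f * θ u = θ f * u
  rw [Derivation.leibniz, smul_eq_mul, smul_eq_mul]
  ring

theorem ofDer_sum_smul {ι : Type*} (s : Finset ι) (a : ι → PolyRing n)
    (θ : ι → Derivation ℂ (PolyRing n) (PolyRing n)) :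
    ofDer (∑ i ∈ s, a i • θ i) = ∑ i ∈ s, ofPoly (a i) * ofDer (θ i) := by
  apply toOp_injective
  rw [map_sum]
  refine LinearMap.ext fun u => ?_
  rw [LinearMap.sum_apply]
  exact derivation_sum_apply s _ u

theorem algebraMap_eq_ofPoly (z : ℂ) : algebraMap ℂ (D n) z = ofPoly (C z) := by
  apply toOp_injective
  rw [AlgHom.commutes]
  refine LinearMap.ext fun u => ?_
  rw [Module.algebraMap_end_apply]
  exact smul_eq_C_mul u z

/-- Constants are central; hence `β` disappears from all commutators of generators. -/
theorem sub_algebraMap_mul_sub (P Q : D n) (z : ℂ) :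
    (P - algebraMap ℂ (D n) z) * Q - Q * (P - algebraMap ℂ (D n) z) = P * Q - Q * P := by
  rw [sub_mul, mul_sub, Algebra.commutes z Q]
  abel

theorem extDer_lie (θ η : Derivation ℂ (PolyRing n) (PolyRing n)) :
    ⁅extDer θ, extDer η⁆ = extDer ⁅θ, η⁆ := by
  refine MvPolynomial.derivation_ext fun i => ?_
  rw [Derivation.commutator_apply]
  refine Fin.cases ?_ (fun i => ?_) i
  · rw [extDer_X_zero, extDer_X_zero, extDer_X_zero, map_zero, map_zero, sub_zero]
  · rw [extDer_X_succ, extDer_X_succ, extDer_X_succ, extDer_extPoly, extDer_extPoly,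
      Derivation.commutator_apply, extPoly, extPoly, extPoly, map_sub]

theorem eulerTilde_apply (p : Fin n → ℚ) (f : PolyRing (n + 1)) :
    eulerTilde p f = extDer (eulerField p) f + X 0 * pderiv 0 f := rfl

theorem pderiv_zero_extPoly (f : PolyRing n) : pderiv 0 (extPoly f) = 0 := by
  induction f using MvPolynomial.induction_on with
  | C a => simp [extPoly]
  | add p q hp hq =>
    simp only [extPoly, map_add] at hp hq ⊢
    rw [hp, hq, add_zero]
  | mul_X p i hp =>
    simp only [extPoly, map_mul, rename_X] at hp ⊢
    rw [pderiv_mul, hp, pderiv_X_of_ne (Fin.succ_ne_zero i), zero_mul, mul_zero, add_zero]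

/-- The summand `w_0 ∂_0` commutes with vector fields in the other variables. -/
theorem eulerTilde_lie (p : Fin n → ℚ) (η : Derivation ℂ (PolyRing n) (PolyRing n)) :
    ⁅eulerTilde p, extDer η⁆ = extDer ⁅eulerField p, η⁆ := by
  rw [← extDer_lie]
  refine MvPolynomial.derivation_ext fun i => ?_
  rw [Derivation.commutator_apply, Derivation.commutator_apply, eulerTilde_apply, eulerTilde_apply]
  refine Fin.cases ?_ (fun i => ?_) i
  · have h1 : extDer η ((X 0 : PolyRing (n + 1)) * 1) = 0 := by rw [mul_one, extDer_X_zero]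
    rw [extDer_X_zero, map_zero, map_zero, mul_zero, add_zero, pderiv_X_self, map_add, h1, add_zero]
  · rw [extDer_X_succ, pderiv_zero_extPoly, pderiv_X_of_ne (Fin.succ_ne_zero i)]
    simp only [mul_zero, add_zero]

theorem eulerField_apply_eq {p : Fin n → ℚ} {h : PolyRing n} {e : ℚ}
    (hqh : MvPolynomial.IsWeightedHomogeneous p h e) : eulerField p h = C (e : ℂ) * h := by
  have h1 : ∀ f, eulerField p f = ∑ i, C (p i : ℂ) * (X i * pderiv i f) := fun f => by
    conv_lhs => rw [derivation_eq_sum (eulerField p)]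
    rw [derivation_sum_apply]
    refine Finset.sum_congr rfl fun i _ => ?_
    rw [Derivation.smul_apply, smul_eq_mul, eulerField, mkDerivation_X, mul_assoc]
  rw [h.as_sum, map_sum, Finset.mul_sum]
  refine Finset.sum_congr rfl fun α hα => ?_
  rw [h1]
  have h2 := hqh (mem_support_iff.mp hα)
  rw [Finsupp.weight_apply, Finsupp.sum_fintype _ _ (by simp)] at h2
  simp only [X_mul_pderiv_monomial]
  rw [← h2]
  simp only [nsmul_eq_mul]
  push_cast
  rw [map_sum, Finset.sum_mul]
  refine Finset.sum_congr rfl fun i _ => ?_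
  rw [map_mul, C_eq_coe_nat]
  ring

theorem extDer_sum_smul {ι : Type*} (s : Finset ι) (a : ι → PolyRing n)
    (θ : ι → Derivation ℂ (PolyRing n) (PolyRing n)) :
    extDer (∑ i ∈ s, a i • θ i) = ∑ i ∈ s, extPoly (a i) • extDer (θ i) := by
  refine MvPolynomial.derivation_ext fun j => ?_
  rw [derivation_sum_apply]
  refine Fin.cases ?_ (fun j => ?_) j
  · rw [extDer_X_zero]
    refine (Finset.sum_eq_zero fun i _ => ?_).symm
    rw [Derivation.smul_apply, extDer_X_zero, smul_zero]
  · rw [extDer_X_succ, derivation_sum_apply, extPoly, map_sum]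
    refine Finset.sum_congr rfl fun i _ => ?_
    rw [Derivation.smul_apply, Derivation.smul_apply, extDer_X_succ, smul_eq_mul, smul_eq_mul, map_mul]
    rfl

theorem extDer_hTilde (θ : Derivation ℂ (PolyRing n) (PolyRing n)) (h : PolyRing n) (c : ℂ) (d : ℕ) :
    extDer θ (hTilde h c d) = extPoly (θ h) := by
  rw [hTilde, map_sub, extDer_extPoly, Derivation.leibniz, Derivation.leibniz_pow, extDer_X_zero,
    derivation_C]
  simp

/-- Giving `w_0` weight one makes `w_0^d` of the same degree `d` as `h`. -/
theorem eulerTilde_hTilde {p : Fin n → ℚ} {h : PolyRing n} {d : ℕ} (c : ℂ)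
    (hh : eulerField p h = C (d : ℂ) * h) :
    eulerTilde p (hTilde h c d) = C (d : ℂ) * hTilde h c d := by
  have h1 : (X 0 : PolyRing (n + 1)) * pderiv 0 (X 0 ^ d : PolyRing (n + 1)) = C (d : ℂ) * X 0 ^ d := by
    rw [Derivation.leibniz_pow, pderiv_X_self]
    cases d with
    | zero => simp
    | succ d =>
      rw [Nat.add_sub_cancel, smul_eq_mul, mul_one, nsmul_eq_mul, pow_succ, map_natCast]
      ring
  rw [eulerTilde_apply, extDer_hTilde, hh, hTilde, map_sub, pderiv_zero_extPoly, pderiv_C_mul, extPoly,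
    extPoly, map_mul, rename_C, zero_sub]
  linear_combination (-C c) * h1

end Commutators

/-! ### The generators of `I(β)` -/

section Generators

variable {m d : ℕ} {p : Fin (m + 1) → ℚ} {h : PolyRing (m + 1)}
  {δ : Fin m → Derivation ℂ (PolyRing (m + 1)) (PolyRing (m + 1))} {c β : ℂ}

/-- The list `generators` as a family. -/
noncomputable def genOp (p : Fin (m + 1) → ℚ) (d : ℕ) (h : PolyRing (m + 1))
    (δ : Fin m → Derivation ℂ (PolyRing (m + 1)) (PolyRing (m + 1))) (c β : ℂ) : Fin (m + 2) → D (m + 2) :=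
  Fin.cons (ofPoly (hTilde h c d)) (Fin.snoc (α := fun _ => D (m + 2)) (fun i => ofDer (extDer (δ i)))
    (ofDer (eulerTilde p) - algebraMap ℂ (D (m + 2)) (d * β)))

/-- The symbols of the generators. -/
noncomputable def genSymbol (p : Fin (m + 1) → ℚ) (d : ℕ) (h : PolyRing (m + 1))
    (δ : Fin m → Derivation ℂ (PolyRing (m + 1)) (PolyRing (m + 1))) (c : ℂ) : Fin (m + 2) → Gr (m + 2) :=
  Fin.cons (C (hTilde h c d)) (Fin.snoc (α := fun _ => Gr (m + 2)) (fun i => derSymbol _ (extDer (δ i)))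
    (derSymbol _ (eulerTilde p)))

/-- The orders of the generators. -/
def genOrder (m : ℕ) : Fin (m + 2) → ℕ := Fin.cons 0 fun _ => 1

theorem generators_eq : generators p d h δ c β = List.ofFn (genOp p d h δ c β) := by
  rw [generators, genOp, List.ofFn_succ, Fin.cons_zero]
  congr 1
  rw [List.ofFn_succ_last]
  simp only [Fin.cons_succ, Fin.snoc_castSucc, Fin.snoc_last]

theorem derSymbol_eulerTilde_ne_zero (p : Fin (m + 1) → ℚ) : derSymbol (m + 2) (eulerTilde p) ≠ 0 := by
  intro h0
  have h1 := coeff_derSymbol (eulerTilde p) 0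
  rw [h0, coeff_zero, eulerTilde_apply, extDer_X_zero, pderiv_X_self, mul_one, zero_add] at h1
  exact X_ne_zero _ h1.symm

theorem genSymbol_isHomogeneous (i : Fin (m + 2)) :
    (genSymbol p d h δ c i).IsHomogeneous (genOrder m i) := by
  refine Fin.cases ?_ (fun i => ?_) i
  · exact isHomogeneous_C _ _
  · simp only [genSymbol, genOrder, Fin.cons_succ]
    refine Fin.lastCases ?_ (fun i => ?_) i
    · rw [Fin.snoc_last]
      exact derSymbol_isHomogeneous _
    · rw [Fin.snoc_castSucc]
      exact derSymbol_isHomogeneous _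

theorem totalSymbol_genOp_sub_mem (i : Fin (m + 2)) :
    totalSymbol (m + 2) (genOp p d h δ c β i) - genSymbol p d h δ c i ∈
      degLE (m + 2) (genOrder m i - 1) := by
  refine Fin.cases ?_ (fun i => ?_) i
  · simp only [genOp, genSymbol, Fin.cons_zero, totalSymbol_ofPoly, sub_self]
    exact zero_mem _
  · simp only [genOp, genSymbol, genOrder, Fin.cons_succ]
    refine Fin.lastCases ?_ (fun i => ?_) i
    · rw [Fin.snoc_last, Fin.snoc_last, map_sub, totalSymbol_ofDer, sub_sub_cancel_left, neg_mem_iff,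
        algebraMap_eq_ofPoly, totalSymbol_ofPoly]
      exact monomial_mem_degLE (by simp) _
    · rw [Fin.snoc_castSucc, Fin.snoc_castSucc, totalSymbol_ofDer, sub_self]
      exact zero_mem _

theorem symbol_genOp (i : Fin (m + 2)) : symbol (genOp p d h δ c β i) = genSymbol p d h δ c i := by
  refine Fin.cases ?_ (fun i => ?_) i
  · exact symbol_ofPoly _
  · refine Fin.lastCases ?_ (fun i => ?_) i
    · refine symbol_eq_of_sub_mem (genSymbol_isHomogeneous _) (totalSymbol_genOp_sub_mem _) fun h0 => ?_
      simp only [genSymbol, Fin.cons_succ, Fin.snoc_last] at h0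
      exact absurd h0 (derSymbol_eulerTilde_ne_zero p)
    · simp only [genOp, genSymbol, Fin.cons_succ, Fin.snoc_castSucc]
      exact symbol_ofDer _

theorem map_symbol_generators :
    (generators p d h δ c β).map symbol = List.ofFn (genSymbol p d h δ c) := by
  rw [generators_eq, List.map_ofFn]
  congr 1
  exact funext symbol_genOp

/-- Expand `η` in the logarithmic generators and apply it to `h`: only the `χ` term survives, giving
its coefficient times `d h`, so that coefficient is zero. -/
theorem exists_combination_of_apply_eq_zero (hh0 : h ≠ 0) (hd : 0 < d)
    (hχ : eulerField p h = C (d : ℂ) * h) (hδ : ∀ i, δ i h = 0)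
    (hspan : Submodule.span (PolyRing (m + 1)) (Set.range
      (Fin.snoc (α := fun _ => Derivation ℂ (PolyRing (m + 1)) (PolyRing (m + 1))) δ (eulerField p))) =
        derLog h)
    {η : Derivation ℂ (PolyRing (m + 1)) (PolyRing (m + 1))} (hη : η h = 0) :
    ∃ a : Fin m → PolyRing (m + 1), η = ∑ i, a i • δ i := by
  have h1 : η ∈ derLog h := by
    change η h ∈ Ideal.span {h}
    rw [hη]
    exact zero_mem _
  rw [← hspan, Submodule.mem_span_range_iff_exists_fun] at h1
  obtain ⟨b, hb⟩ := h1
  rw [Fin.sum_univ_castSucc] at hb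
  simp only [Fin.snoc_castSucc, Fin.snoc_last] at hb
  refine ⟨fun i => b i.castSucc, ?_⟩
  have h2 : b (Fin.last m) = 0 := by
    have h3 := congrArg (fun θ => θ h) hb
    simp only [Derivation.add_apply, derivation_sum_apply, Derivation.smul_apply, hδ, hχ, hη, smul_eq_mul,
      mul_zero, Finset.sum_const_zero, zero_add] at h3
    have hd' : (C (d : ℂ) : PolyRing (m + 1)) ≠ 0 := by
      rw [Ne, C_eq_zero]
      exact_mod_cast hd.ne'
    exact (mul_eq_zero.mp h3).resolve_right (mul_ne_zero hd' hh0)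
  rw [← hb, h2, zero_smul, add_zero]

/-- `P` is a combination of the generators with coefficients of order as small as `s` permits. -/
def IsBoundedCombination (p : Fin (m + 1) → ℚ) (d : ℕ) (h : PolyRing (m + 1))
    (δ : Fin m → Derivation ℂ (PolyRing (m + 1)) (PolyRing (m + 1))) (c β : ℂ) (s : ℤ) (P : D (m + 2)) :
    Prop :=
  ∃ A : Fin (m + 2) → D (m + 2), (∀ l, A l ∈ ordLE (m + 2) (s - genOrder m l)) ∧
    P = ∑ l, A l * genOp p d h δ c β l

theorem IsBoundedCombination.zero (s : ℤ) : IsBoundedCombination p d h δ c β s 0 :=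
  ⟨0, fun _ => zero_mem _, by simp⟩

theorem IsBoundedCombination.neg {s : ℤ} {P : D (m + 2)} (hP : IsBoundedCombination p d h δ c β s P) :
    IsBoundedCombination p d h δ c β s (-P) := by
  obtain ⟨A, hA, rfl⟩ := hP
  exact ⟨-A, fun l => neg_mem (hA l), by simp⟩

theorem IsBoundedCombination.ofPoly_mul_hTilde (f : PolyRing (m + 2)) :
    IsBoundedCombination p d h δ c β 0 (ofPoly f * ofPoly (hTilde h c d)) := by
  refine ⟨Fin.cons (ofPoly f) 0, fun l => ?_, ?_⟩
  · refine Fin.cases ?_ (fun l => ?_) l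
    · simp only [Fin.cons_zero, genOrder]
      exact ofPoly_mem f
    · simp only [Fin.cons_succ]
      exact zero_mem _
  · rw [Fin.sum_univ_succ]
    simp [genOp]

theorem IsBoundedCombination.ofDer_extDer
    {η : Derivation ℂ (PolyRing (m + 1)) (PolyRing (m + 1))}
    (hη : ∃ a : Fin m → PolyRing (m + 1), η = ∑ i, a i • δ i) :
    IsBoundedCombination p d h δ c β 1 (ofDer (extDer η)) := by
  obtain ⟨a, rfl⟩ := hη
  refine ⟨Fin.cons 0 (Fin.snoc (α := fun _ => D (m + 2)) (fun i => ofPoly (extPoly (a i))) 0),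
    fun l => ?_, ?_⟩
  · refine Fin.cases ?_ (fun l => ?_) l
    · exact zero_mem _
    · simp only [Fin.cons_succ, genOrder]
      refine Fin.lastCases ?_ (fun l => ?_) l
      · rw [Fin.snoc_last]
        exact zero_mem _
      · rw [Fin.snoc_castSucc]
        exact ofPoly_mem _
  · rw [extDer_sum_smul, ofDer_sum_smul, Fin.sum_univ_succ, Fin.sum_univ_castSucc]
    simp [genOp]

/-- Brackets among the `δ_i` and with `χ` again annihilate `h`, hence are combinations of the `δ_i`
alone. The function `h - c w_0^d` is killed by the `δ_i` and is an eigenfunction of the extended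
Euler field. -/
theorem isBoundedCombination_commutator (hχ : eulerField p h = C (d : ℂ) * h) (hδ : ∀ i, δ i h = 0)
    (hcomb : ∀ η : Derivation ℂ (PolyRing (m + 1)) (PolyRing (m + 1)), η h = 0 →
      ∃ a : Fin m → PolyRing (m + 1), η = ∑ i, a i • δ i) (i j : Fin (m + 2)) :
    IsBoundedCombination p d h δ c β (genOrder m i + genOrder m j - 1)
      (genOp p d h δ c β i * genOp p d h δ c β j - genOp p d h δ c β j * genOp p d h δ c β i) := by
  have hswap : ∀ i j, IsBoundedCombination p d h δ c β (genOrder m i + genOrder m j - 1)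
      (genOp p d h δ c β i * genOp p d h δ c β j - genOp p d h δ c β j * genOp p d h δ c β i) →
      IsBoundedCombination p d h δ c β (genOrder m j + genOrder m i - 1)
      (genOp p d h δ c β j * genOp p d h δ c β i - genOp p d h δ c β i * genOp p d h δ c β j) :=
    fun i j H => by
      have := H.neg
      rwa [neg_sub, add_comm (genOrder m i : ℤ)] at this
  have hpoly : ∀ i : Fin (m + 1), IsBoundedCombination p d h δ c β (genOrder m i.succ + genOrder m 0 - 1)
      (genOp p d h δ c β i.succ * genOp p d h δ c β 0 - genOp p d h δ c β 0 * genOp p d h δ c β i.succ) := by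
    intro i
    simp only [genOp, genOrder, Fin.cons_zero, Fin.cons_succ]
    refine Fin.lastCases ?_ (fun i => ?_) i
    · rw [Fin.snoc_last, sub_algebraMap_mul_sub, ofDer_mul_ofPoly_sub, eulerTilde_hTilde c hχ]
      have h1 : (ofPoly (C (d : ℂ) * hTilde h c d) : D (m + 2)) =
          ofPoly (C (d : ℂ)) * ofPoly (hTilde h c d) := by
        apply toOp_injective
        rw [map_mul]
        exact LinearMap.ext fun u => mul_assoc _ _ u
      rw [h1]
      exact IsBoundedCombination.ofPoly_mul_hTilde _
    · rw [Fin.snoc_castSucc, ofDer_mul_ofPoly_sub, extDer_hTilde, hδ]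
      have h1 : (ofPoly (extPoly (0 : PolyRing (m + 1))) : D (m + 2)) = 0 := by
        rw [extPoly, map_zero]
        apply toOp_injective
        rw [map_zero]
        exact LinearMap.ext fun u => zero_mul u
      rw [h1]
      exact IsBoundedCombination.zero _
  have hlast : ∀ i : Fin m, IsBoundedCombination p d h δ c β
      (genOrder m (Fin.last m).succ + genOrder m i.castSucc.succ - 1)
      (genOp p d h δ c β (Fin.last m).succ * genOp p d h δ c β i.castSucc.succ -
        genOp p d h δ c β i.castSucc.succ * genOp p d h δ c β (Fin.last m).succ) := by
    intro i
    simp only [genOp, genOrder, Fin.cons_succ, Fin.snoc_last, Fin.snoc_castSucc]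
    rw [sub_algebraMap_mul_sub, ofDer_mul_sub, eulerTilde_lie]
    refine IsBoundedCombination.ofDer_extDer (hcomb _ ?_)
    rw [Derivation.commutator_apply, hδ, hχ, Derivation.leibniz, hδ, derivation_C]
    simp
  refine Fin.cases ?_ (fun i => ?_) i
  · refine Fin.cases ?_ (fun j => hswap _ _ (hpoly j)) j
    rw [sub_self]
    exact IsBoundedCombination.zero _
  · refine Fin.cases (hpoly i) (fun j => ?_) j
    refine Fin.lastCases ?_ (fun i => ?_) i
    · refine Fin.lastCases ?_ (fun j => hlast j) j
      rw [sub_self]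
      exact IsBoundedCombination.zero _
    · refine Fin.lastCases (hswap _ _ (hlast i)) (fun j => ?_) j
      simp only [genOp, genOrder, Fin.cons_succ, Fin.snoc_castSucc]
      rw [ofDer_mul_sub, extDer_lie]
      refine IsBoundedCombination.ofDer_extDer (hcomb _ ?_)
      rw [Derivation.commutator_apply, hδ, hδ, map_zero, map_zero, sub_zero]

/-! ### Regularity of the symbols of the generators -/

theorem map_symbol_koszulOps :
    (koszulOps h δ).map symbol =
      List.ofFn (Fin.cons (C h) fun i => derSymbol _ (δ i) : Fin (m + 1) → Gr (m + 1)) := by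
  rw [koszulOps, List.map_cons, List.map_ofFn, List.ofFn_succ, Fin.cons_zero, symbol_ofPoly]
  simp only [Fin.cons_succ]
  congr 2
  exact funext fun i => symbol_ofDer _

theorem isRegFam_derSymbol
    (hbasis : IsLogBasis h (Fin.snoc (α := fun _ => Derivation ℂ (PolyRing (m + 1)) (PolyRing (m + 1)))
      δ (eulerField p))) (hh0 : h ≠ 0)
    (hreg : ∀ t f, C h * f ∈ spanLT ⊥ (fun i => derSymbol _ (δ i)) t →
      f ∈ spanLT ⊥ (fun i => derSymbol _ (δ i)) t) :
    IsRegFam ⊥ fun i => derSymbol _ (δ i) := by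
  intro i
  have hsnoc : (fun j => derSymbol _ ((Fin.snoc (α := fun _ => Derivation ℂ (PolyRing (m + 1))
      (PolyRing (m + 1))) δ (eulerField p)) j)) =
      (Fin.snoc (α := fun _ => Gr (m + 1)) (fun i => derSymbol _ (δ i)) (derSymbol _ (eulerField p))) := by
    funext j
    refine Fin.lastCases ?_ (fun j => ?_) j
    · rw [Fin.snoc_last, Fin.snoc_last]
    · rw [Fin.snoc_castSucc, Fin.snoc_castSucc]
  have h1 := mem_spanLT_of_derSymbol_mul_mem hbasis.1 hh0 (fun j => ?_) i.castSucc
  · rw [hsnoc, Fin.val_castSucc, spanLT_snoc _ _ _ i.2.le, Fin.snoc_castSucc] at h1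
    exact h1 (hreg i)
  -- `h ∂_j` is logarithmic because it sends `h` to a multiple of `h`.
  · rw [hbasis.2]
    exact Ideal.mul_mem_right _ _ (Ideal.mem_span_singleton_self h)

theorem isRegFam_genSymbol (hd : 0 < d) (hc : c ≠ 0)
    (hbasis : IsLogBasis h (Fin.snoc (α := fun _ => Derivation ℂ (PolyRing (m + 1)) (PolyRing (m + 1)))
      δ (eulerField p))) (hh0 : h ≠ 0)
    (hSK : IsRegFam ⊥ (Fin.cons (C h) fun i => derSymbol _ (δ i) : Fin (m + 1) → Gr (m + 1))) :
    IsRegFam ⊥ (genSymbol p d h δ c) := by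
  rw [isRegFam_cons_iff] at hSK
  have h1 := mem_spanLT_of_mul_mem hSK.1 hSK.2
  have h2 := isRegFam_derSymbol hbasis hh0 h1
  have hu : IsUnit (C (C c) : Gr (m + 1)) := ((isUnit_iff_ne_zero.mpr hc).map C).map C
  have h3 := (h2.adjoin_variables (x := derSymbol _ (eulerField p)) hd hu h1).map_ringEquiv
    (extGrEquiv (m + 1))
  convert h3 using 1
  funext i
  refine Fin.cases ?_ (fun i => ?_) i
  · simp only [genSymbol, Fin.cons_zero]
    exact (extGrEquiv_hTilde h c d).symm
  · simp only [genSymbol, Fin.cons_succ]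
    refine Fin.lastCases ?_ (fun i => ?_) i
    · rw [Fin.snoc_last, Fin.snoc_last, map_add, map_mul, extGrEquiv_C_C, extGrEquiv_C_X, extGrEquiv_X,
        derSymbol_eulerTilde]
    · rw [Fin.snoc_castSucc, Fin.snoc_castSucc, extGrEquiv_C_C, derSymbol_extDer]

theorem span_genSymbol_ne_top (hd : 0 < d) (hc : c ≠ 0) :
    Ideal.span (Set.range (genSymbol p d h δ c)) ≠ ⊤ := by
  -- With `c t^d = h(0)`, all symbols vanish at `w_0 = t`, `w = 0`, `ξ = 0`.
  obtain ⟨t, ht⟩ := IsAlgClosed.exists_pow_nat_eq (eval 0 h / c) hd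
  let ev : Gr (m + 2) →+* ℂ := eval₂Hom (eval (Fin.cons t 0 : Fin (m + 2) → ℂ)) 0
  have hder : ∀ θ, ev (derSymbol _ θ) = 0 := fun θ => by
    rw [derSymbol_apply, map_sum]
    refine Finset.sum_eq_zero fun i _ => ?_
    simp [ev, smul_eq_C_mul]
  have hev : ∀ i, ev (genSymbol p d h δ c i) = 0 := by
    refine Fin.cases ?_ fun i => ?_
    · have h1 : eval (Fin.cons t 0 : Fin (m + 2) → ℂ) (extPoly h) = eval 0 h := by
        rw [extPoly, eval_rename]
        rfl
      simp only [genSymbol, Fin.cons_zero, ev, coe_eval₂Hom, eval₂_C]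
      rw [hTilde, map_sub, h1, map_mul, map_pow, eval_C, eval_X, Fin.cons_zero, ht]
      rw [mul_div_assoc', mul_div_cancel_left₀ _ hc, sub_self]
    · simp only [genSymbol, Fin.cons_succ]
      refine Fin.lastCases ?_ (fun i => ?_) i
      · rw [Fin.snoc_last, hder]
      · rw [Fin.snoc_castSucc, hder]
  intro htop
  have hle : Ideal.span (Set.range (genSymbol p d h δ c)) ≤ RingHom.ker ev := by
    rw [Ideal.span_le]
    rintro _ ⟨i, rfl⟩
    exact hev i
  rw [htop, top_le_iff] at hle
  exact RingHom.ker_ne_top ev hle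

end Generators

end AlgDMod

open AlgDMod in
theorem mainTheorem11 (m d : ℕ) (hd : 0 < d) (p : Fin (m + 1) → ℚ)
    (h : PolyRing (m + 1)) (hred : Squarefree h)
    (hqh : MvPolynomial.IsWeightedHomogeneous p h (d : ℚ))
    (δ : Fin m → Derivation ℂ (PolyRing (m + 1)) (PolyRing (m + 1)))
    (hbasis : IsLogBasis h (Fin.snoc (α := fun _ => Derivation ℂ (PolyRing (m + 1)) (PolyRing (m + 1)))
      δ (eulerField p)))
    (hδ : ∀ i, δ i h = 0)
    (hSK : RingTheory.Sequence.IsRegular (Gr (m + 1)) ((koszulOps h δ).map symbol))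
    (c : ℂ) (hc : c ≠ 0) (β : ℂ) :
    IsHolonomic (m + 2) (moduleN p d h δ c β) ∧
    IsInvolutiveBasis (generators p d h δ c β) (idealI p d h δ c β) ∧
    RingTheory.Sequence.IsRegular (Gr (m + 2)) ((generators p d h δ c β).map symbol) := by
  -- Reducedness enters only through `h ≠ 0`.
  have hh0 : h ≠ 0 := hred.ne_zero
  have hχ : eulerField p h = MvPolynomial.C (d : ℂ) * h := by
    have := eulerField_apply_eq hqh
    rwa [Rat.cast_natCast] at this
  rw [map_symbol_koszulOps, isRegular_ofFn_iff] at hSK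
  have hreg := isRegFam_genSymbol hd hc hbasis hh0 hSK.1
  have htop := span_genSymbol_ne_top (p := p) (h := h) (δ := δ) hd hc
  have hI : idealI p d h δ c β = Submodule.span (D (m + 2)) (Set.range (genOp p d h δ c β)) := by
    rw [idealI, leftIdeal, generators_eq]
    congr 1
    ext P
    simp only [Set.mem_ofPred_eq, List.mem_ofFn, Set.mem_range]
  have hinv := symbolIdeal_eq_span genSymbol_isHomogeneous totalSymbol_genOp_sub_mem symbol_genOp hreg
    (isBoundedCombination_commutator (β := β) hχ hδ fun η hη =>
      exists_combination_of_apply_eq_zero hh0 hd hχ hδ hbasis.2 hη)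
  rw [← hI] at hinv
  refine ⟨isHolonomic_quotient ?_, ⟨rfl, ?_⟩, ?_⟩
  · rw [hinv]
    exact ringKrullDim_gr_quotient hreg htop
  · rw [hinv, map_symbol_generators, Ideal.ofList]
    congr 1
    ext x
    simp only [Set.mem_ofPred_eq, List.mem_ofFn, Set.mem_range]
  · rw [map_symbol_generators, isRegular_ofFn_iff]
    exact ⟨hreg, htop⟩
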